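/- Let $k$ be an algebraically closed field of characteristic $p\ge 0$ and let $n\ge 4$ be even. Let $W_4$, $W_n$ be symplectic spaces over $k$ of dimensions $4$ and $n$, and equip $V=W_4\otimes W_n$ with the quadratic form $Q$ whose polar form is the product of the two symplectic forms and which vanishes on all pure tensors. Let $H=Sp_4\otimes Sp_n\le GL(V)$ be the image of $Sp_4(k)\times Sp_n(k)$. (1) $H$ has finitely many orbits on the singular $1$-spaces of $V$. (2) There is an $H$-orbit on singular $1$-spaces that is Zariski dense in the variety of singular $1$-spaces. If $\langle v\rangle$ is any singular $1$-space whose $H$-orbit is dense, then the group $\overline{H_{\langle v\rangle}}$ which the stabilizer $H_{\langle v\rangle}$ induces on the $1$-spaces of $V$ (its image in $PGL(V)$) has the form $$(A_1A_1).2\,(Sp_{n-4})\ \text{ if } p\ne 2,\qquad (U_3A_1)(Sp_{n-4})\ \text{ if } p=2 ,$$ where $Sp_0$ is the trivial group. Precisely: let $X\le SL_4(k)$ be the wreath product $SL_2(k)\wr Sym_2=(SL_2(k)\times SL_2(k)).2$ of block matrices $\begin{pmatrix}A&0\\0&D\end{pmatrix}$, $\begin{pmatrix}0&A\\D&0\end{pmatrix}$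 with $A,D\in SL_2(k)$ if $p\neq2$, and the semidirect product $U_3\,SL_2(k)$ of the matrices $\begin{pmatrix}A&AS\\0&A^{-T}\end{pmatrix}$ with $A\in SL_2(k)$, $S=S^T\in M_2(k)$ if $p=2$. Then there is a homomorphism $\rho:X\times Sp_{n-4}(k)\to GL(V)$ whose matrix entries are polynomials in the matrix entries of the argument, such that the composite $X\times Sp_{n-4}(k)\to PGL(V)$ has image $\overline{H_{\langle v\rangle}}$ and kernel $\{(1,1),(-1,-1)\}$ (which is trivial when $p=2$). -/

import Mathlib

open Matrix MatrixGroups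
open scoped LinearAlgebra.Projectivization Kronecker

namespace TensorSp

/-- Index set of the standard basis `e_1, …, e_r, f_1, …, f_r` of the natural module `W_{2r}` of
`Sp_{2r}`: `e_i` is indexed by `Sum.inl i` and `f_i` by `Sum.inr i`. -/
abbrev Idx (r : ℕ) : Type := Fin r ⊕ Fin r

/-- `Sp_{2r}(k)`, the matrices `A` with `A J Aᵀ = J`. -/
abbrev Sp (k : Type*) [CommRing k] (r : ℕ) := Matrix.symplecticGroup (Fin r) k

/-- `V = W_4 ⊗ W_{2m}`, in coordinates with respect to the basis of pure tensors of standard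
basis vectors. -/
abbrev V (k : Type*) (m : ℕ) : Type _ := Idx 2 × Idx m → k

/-- The pure tensor `a ⊗ b`. -/
def tmul {k : Type*} [CommRing k] {m : ℕ} (a : Idx 2 → k) (b : Idx m → k) : V k m :=
  fun p => a p.1 * b p.2

/-- The action of `Sp_4 × Sp_{2m}` on `W_4 ⊗ W_{2m}`, `(g, h) ↦ g ⊗ h`. -/
def tensorHom (k : Type*) [CommRing k] (m : ℕ) : Sp k 2 × Sp k m →* GL (Idx 2 × Idx m) k :=
  MonoidHom.toHomUnits
    { toFun := fun p => (p.1 : Matrix (Idx 2) (Idx 2) k) ⊗ₖ (p.2 : Matrix (Idx m) (Idx m) k)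
      map_one' := by simp
      map_mul' := fun p q => by simp [Matrix.mul_kronecker_mul] }

/-- The linear group `Sp_4 ⊗ Sp_{2m} ≤ GL(W_4 ⊗ W_{2m})`. -/
def tensorGroup (k : Type*) [CommRing k] (m : ℕ) : Subgroup (GL (Idx 2 × Idx m) k) :=
  (tensorHom k m).range

/-- The quadratic form on `W_4 ⊗ W_{2m}` whose polar form is the product of the two symplectic
forms and for which pure tensors are singular (see the next two lemmas). -/
def Q {k : Type*} [CommRing k] {m : ℕ} (v : V k m) : k :=
  ∑ i : Fin 2, ∑ j : Fin m,
    (v (Sum.inl i, Sum.inl j) * v (Sum.inr i, Sum.inr j) -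
      v (Sum.inl i, Sum.inr j) * v (Sum.inr i, Sum.inl j))

theorem Q_tmul {k : Type*} [CommRing k] {m : ℕ} (a : Idx 2 → k) (b : Idx m → k) :
    Q (tmul a b) = 0 := by
  unfold Q tmul
  refine Finset.sum_eq_zero fun i _ => Finset.sum_eq_zero fun j _ => ?_
  ring

theorem Q_tmul_add_tmul {k : Type*} [CommRing k] {m : ℕ} (a c : Idx 2 → k) (b d : Idx m → k) :
    Q (tmul a b + tmul c d) =
      (a ⬝ᵥ (Matrix.J (Fin 2) k *ᵥ c)) * (b ⬝ᵥ (Matrix.J (Fin m) k *ᵥ d)) := by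
  have key : ∀ (r : ℕ) (x y : Idx r → k), x ⬝ᵥ (Matrix.J (Fin r) k *ᵥ y) =
      ∑ i : Fin r, (x (Sum.inr i) * y (Sum.inl i) - x (Sum.inl i) * y (Sum.inr i)) := by
    intro r x y
    rw [Matrix.J, Matrix.fromBlocks_mulVec]
    simp [dotProduct, Matrix.neg_mulVec, Fintype.sum_sum_type, Finset.sum_sub_distrib]
    ring
  rw [key, key, Finset.sum_mul_sum]
  unfold Q tmul
  refine Finset.sum_congr rfl fun i _ => Finset.sum_congr rfl fun j _ => ?_
  simp only [Pi.add_apply]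
  ring

/-- The singular 1-spaces of `W_4 ⊗ W_{2m}`. -/
def singularPoints (k : Type*) [Field k] (m : ℕ) : Set (ℙ k (V k m)) :=
  {x | ∀ v ∈ x.submodule, Q v = 0}

/-- The orbit of `x` under `Sp_4 ⊗ Sp_{2m}` on 1-spaces. -/
def orbit {k : Type*} [Field k] {m : ℕ} (x : ℙ k (V k m)) : Set (ℙ k (V k m)) :=
  MulAction.orbit (tensorGroup k m) x

/-- The orbit of `x` is Zariski dense in the variety of singular 1-spaces: a homogeneous polynomial
that vanishes on the orbit vanishes on all singular 1-spaces. -/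
def HasDenseOrbit {k : Type*} [Field k] {m : ℕ} (x : ℙ k (V k m)) : Prop :=
  ∀ (d : ℕ) (F : MvPolynomial (Idx 2 × Idx m) k), F.IsHomogeneous d →
    (∀ y ∈ orbit x, MvPolynomial.eval y.rep F = 0) →
      ∀ y ∈ singularPoints k m, MvPolynomial.eval y.rep F = 0

/-- The group induced on the 1-spaces of `W_4 ⊗ W_{2m}` by the stabilizer of `x` in
`Sp_4 ⊗ Sp_{2m}`, that is, the image of this stabilizer in `PGL(W_4 ⊗ W_{2m})`. -/
def inducedStabilizer {k : Type*} [Field k] {m : ℕ} (x : ℙ k (V k m)) :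
    Subgroup PGL(Idx 2 × Idx m, k) :=
  (tensorGroup k m ⊓ MulAction.stabilizer (GL (Idx 2 × Idx m) k) x).map ProjGenLinGroup.mk

/-- `(A_1 A_1).2`: the stabilizer `SL_2 ≀ Sym_2` in `Sp_4` of an unordered orthogonal decomposition
of `W_4` into two non-degenerate planes, in a basis adapted to the decomposition. -/
def A1A1two (k : Type*) [Field k] : Subgroup (GL (Fin 2 ⊕ Fin 2) k) where
  carrier := {g | ∃ A D : Matrix (Fin 2) (Fin 2) k, A.det = 1 ∧ D.det = 1 ∧
    ((g : Matrix (Fin 2 ⊕ Fin 2) (Fin 2 ⊕ Fin 2) k) = fromBlocks A 0 0 D ∨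
      (g : Matrix (Fin 2 ⊕ Fin 2) (Fin 2 ⊕ Fin 2) k) = fromBlocks 0 A D 0)}
  one_mem' := ⟨1, 1, by simp, by simp, Or.inl (by simp)⟩
  mul_mem' := by
    rintro g h ⟨A, D, hA, hD, hg | hg⟩ ⟨B, E, hB, hE, hh | hh⟩
    · exact ⟨A * B, D * E, by simp [hA, hB], by simp [hD, hE],
        Or.inl (by simp [hg, hh, fromBlocks_multiply])⟩
    · exact ⟨A * B, D * E, by simp [hA, hB], by simp [hD, hE],
        Or.inr (by simp [hg, hh, fromBlocks_multiply])⟩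
    · exact ⟨A * E, D * B, by simp [hA, hE], by simp [hD, hB],
        Or.inr (by simp [hg, hh, fromBlocks_multiply])⟩
    · exact ⟨A * E, D * B, by simp [hA, hE], by simp [hD, hB],
        Or.inl (by simp [hg, hh, fromBlocks_multiply])⟩
  inv_mem' := by
    have e : ∀ A : Matrix (Fin 2) (Fin 2) k, A.det = 1 → A * A⁻¹ = 1 := fun A hA =>
      Matrix.mul_nonsing_inv A (by simp [hA])
    rintro g ⟨A, D, hA, hD, hg | hg⟩
    · refine ⟨A⁻¹, D⁻¹, by simp [hA], by simp [hD], Or.inl ?_⟩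
      rw [coe_units_inv, hg]
      exact inv_eq_right_inv (by simp [fromBlocks_multiply, e A hA, e D hD])
    · refine ⟨D⁻¹, A⁻¹, by simp [hD], by simp [hA], Or.inr ?_⟩
      rw [coe_units_inv, hg]
      exact inv_eq_right_inv (by simp [fromBlocks_multiply, e A hA, e D hD])

/-- `U_3 A_1`: the semidirect product of the group `U_3` of symmetric `2 × 2` matrices `S` with
`SL_2` acting by `S ↦ A S Aᵀ`, realised as the subgroup of the matrices
`diag(A, A^{-T}) * [1, S; 0, 1]` in the stabilizer in `Sp_4` of a totally singular plane. -/
def U3A1 (k : Type*) [Field k] : Subgroup (GL (Fin 2 ⊕ Fin 2) k) where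
  carrier := {g | ∃ A S : Matrix (Fin 2) (Fin 2) k, A.det = 1 ∧ Sᵀ = S ∧
    (g : Matrix (Fin 2 ⊕ Fin 2) (Fin 2 ⊕ Fin 2) k) = fromBlocks A (A * S) 0 (A⁻¹)ᵀ}
  one_mem' := ⟨1, 0, by simp, by simp, by simp⟩
  mul_mem' := by
    rintro g h ⟨A, S, hA, hS, hg⟩ ⟨B, T, hB, hT, hh⟩
    have eB : B * B⁻¹ = 1 := Matrix.mul_nonsing_inv B (by simp [hB])
    refine ⟨A * B, T + B⁻¹ * S * (B⁻¹)ᵀ, by simp [hA, hB], ?_, ?_⟩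
    · simp only [transpose_add, transpose_mul, transpose_transpose, hS, hT, Matrix.mul_assoc]
    · have h1 : A * B * (B⁻¹ * S * (B⁻¹)ᵀ) = A * S * (B⁻¹)ᵀ := by
        calc A * B * (B⁻¹ * S * (B⁻¹)ᵀ) = A * (B * B⁻¹) * S * (B⁻¹)ᵀ := by
              simp only [Matrix.mul_assoc]
          _ = _ := by rw [eB, Matrix.mul_one]
      rw [Units.val_mul, hg, hh, fromBlocks_multiply, Matrix.mul_inv_rev, transpose_mul,
        Matrix.mul_add, h1]
      simp [Matrix.mul_assoc]
  inv_mem' := by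
    rintro g ⟨A, S, hA, hS, hg⟩
    have eA : A * A⁻¹ = 1 := Matrix.mul_nonsing_inv A (by simp [hA])
    refine ⟨A⁻¹, -(A * S * Aᵀ), by simp [hA], ?_, ?_⟩
    · simp only [transpose_neg, transpose_mul, transpose_transpose, hS, Matrix.mul_assoc]
    · rw [coe_units_inv, hg]
      refine inv_eq_right_inv ?_
      have h1 : A * (A⁻¹ * -(A * S * Aᵀ)) = -(A * S * Aᵀ) := by
        rw [← Matrix.mul_assoc, eA, Matrix.one_mul]
      have h2 : (A⁻¹)ᵀ * Aᵀ = 1 := by rw [← transpose_mul, eA, transpose_one]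
      rw [fromBlocks_multiply, Matrix.nonsing_inv_nonsing_inv A (by simp [hA]), h1, h2, eA]
      simp

/-- `ρ : X × Sp_{2r} → GL_ι` is a morphism of varieties: its matrix entries are polynomials in the
matrix entries of the argument. This is meant for closed subgroups `X` of `SL_4`, for which inverse
determinants are not needed. -/
def IsPolynomialHom {k : Type*} [Field k] {r : ℕ} {ι : Type*} [Fintype ι] [DecidableEq ι]
    {X : Subgroup (GL (Fin 2 ⊕ Fin 2) k)} (ρ : X × Sp k r →* GL ι k) : Prop :=
  ∀ a b : ι, ∃ P : MvPolynomial
      (((Fin 2 ⊕ Fin 2) × (Fin 2 ⊕ Fin 2)) ⊕ (Idx r × Idx r)) k,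
    ∀ g : X × Sp k r, (ρ g : Matrix ι ι k) a b =
      MvPolynomial.eval
        (Sum.elim (fun c => ((g.1 : GL (Fin 2 ⊕ Fin 2) k) : Matrix _ _ k) c.1 c.2)
          (fun c => (g.2 : Matrix (Idx r) (Idx r) k) c.1 c.2)) P

/-- The subgroup `S` of `PGL_ι(k)` is of the form `X Sp_{2r}`, the central product of `X ≤ SL_4` and
`Sp_{2r}` in which the two elements `-1` are identified: it is the image of `X × Sp_{2r}` under a
homomorphism of algebraic groups, induced by a linear representation, with kernel
`{(1, 1), (-1, -1)}`. -/
def IsCentralProductWithSp {k : Type*} [Field k] {ι : Type*} [Fintype ι] [DecidableEq ι]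
    (X : Subgroup (GL (Fin 2 ⊕ Fin 2) k)) (r : ℕ) (S : Subgroup PGL(ι, k)) : Prop :=
  ∃ ρ : X × Sp k r →* GL ι k, IsPolynomialHom ρ ∧
    (ProjGenLinGroup.mk.comp ρ).range = S ∧
    ∀ g : X × Sp k r, (ProjGenLinGroup.mk.comp ρ) g = 1 ↔
      (((g.1 : GL (Fin 2 ⊕ Fin 2) k) : Matrix (Fin 2 ⊕ Fin 2) (Fin 2 ⊕ Fin 2) k) = 1 ∧
          (g.2 : Matrix (Idx r) (Idx r) k) = 1) ∨
      (((g.1 : GL (Fin 2 ⊕ Fin 2) k) : Matrix (Fin 2 ⊕ Fin 2) (Fin 2 ⊕ Fin 2) k) = -1 ∧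
          (g.2 : Matrix (Idx r) (Idx r) k) = -1)

end TensorSp

/-! A tensor `v` is read as a `4 × 2m` matrix `M`, on which `(g, h)` acts by `M ↦ g M hᵀ`. By Witt's
theorem in `W_{2m}`, the `Sp_{2m}`-orbit of `M` is determined by the linear relations between its
rows and by their Gram matrix `N = M J Mᵀ`, an alternating form on a 4-space. Since `Q v` is minus
the contraction of `N` with the symplectic form, `N` is traceless exactly when `v` is singular. What
remains is to classify such pairs (relations, `N`) under `Sp_4` and scalars.

For traceless `N`, the self-adjoint endomorphism `T` with `B(T a, b) = aᵀ N b` satisfies `T² = pf N`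
(`J_mul_sq`). This leaves few cases: - `N` invertible and not a multiple of `J`: after scaling `T² =
1`, and a symplectic basis `x, T x, y, T y` gives one orbit (`exists_genForm`). - `N` a non-zero
multiple of `J`: one orbit. - `N ≠ 0` degenerate: `T² = 0`, the relations lie in the 2-dimensional
radical of `N`, and there are at most three orbits (`exists_isOfType_degForm`). - `N = 0`: only the
relation space matters. It is a subspace of a symplectic 4-space, and there are finitely many of
these up to isometry (`exists_basis_gram_sign`).

The first case is cut out by polynomial inequations up to the action of `H`. As the quadric is
irreducible (`eval_eq_zero_of_mul`), its orbit is dense, and conversely a dense orbit must be this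
one.

For the stabilizer, a representative is chosen whose rows span a non-degenerate 4-space, `W_{2m} =
W_4 ⊥ W_{2m-4}`. Then `h` splits as `A ⊕ D` with `D` free in `Sp_{2m-4}`, and `A` determines `g`.
The tensor identifies the two 4-spaces, so the other factor is the group of `x ∈ GL_4` preserving
one form `Φ` and, up to a scalar, a second form `Ψ` (`isCentralProductWithSp_of_forms`). If `p ≠ 2`,
the pair is the sum and the difference of the forms of two orthogonal planes (the eigenspaces of
`T`), and the group is `SL_2 ≀ Sym_2`. If `p = 2`, then `T` is a non-trivial unipotent involution,
the two forms differ by a form of rank two, and the group is `U_3 SL_2`. -/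

namespace TensorSp

/-- The standard symplectic form on `l ⊕ l → k`, as a bilinear map. -/
noncomputable def sform (l k : Type*) [Fintype l] [DecidableEq l] [CommRing k] :
    (l ⊕ l → k) →ₗ[k] (l ⊕ l → k) →ₗ[k] k :=
  Matrix.toLinearMap₂' k (J l k)

/-! ### Symplectic spaces, transvections and Witt's theorem -/

section Form

variable {l k : Type*} [Fintype l] [DecidableEq l]

theorem sform_apply [CommRing k] (x y : l ⊕ l → k) :
    sform l k x y = x ⬝ᵥ (J l k *ᵥ y) := by
  simp [sform, Matrix.toLinearMap₂'_apply']

theorem sform_eq_sum [CommRing k] (x y : l ⊕ l → k) :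
    sform l k x y = ∑ i, (x (Sum.inr i) * y (Sum.inl i) - x (Sum.inl i) * y (Sum.inr i)) := by
  rw [sform_apply, Matrix.J, Matrix.fromBlocks_mulVec]
  simp [dotProduct, Matrix.neg_mulVec, Fintype.sum_sum_type, Finset.sum_sub_distrib]
  ring

theorem sform_self [CommRing k] (x : l ⊕ l → k) : sform l k x x = 0 := by
  rw [sform_eq_sum]
  exact Finset.sum_eq_zero fun i _ => by ring

theorem sform_neg [CommRing k] (x y : l ⊕ l → k) : sform l k x y = - sform l k y x := by
  rw [sform_eq_sum, sform_eq_sum, ← Finset.sum_neg_distrib]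
  exact Finset.sum_congr rfl fun i _ => by ring

theorem mulVec_sform [CommRing k] {h : Matrix (l ⊕ l) (l ⊕ l) k} (hh : h ∈ symplecticGroup l k)
    (x y : l ⊕ l → k) : sform l k (h *ᵥ x) (h *ᵥ y) = sform l k x y := by
  rw [SymplecticGroup.mem_iff'] at hh
  have : J l k *ᵥ y = (hᵀ * J l k * h) *ᵥ y := by rw [hh]
  rw [sform_apply, sform_apply, this, ← Matrix.mulVec_mulVec, ← Matrix.mulVec_mulVec,
    Matrix.dotProduct_mulVec x, Matrix.vecMul_transpose]

theorem mem_symplecticGroup_of_sform [CommRing k] {h : Matrix (l ⊕ l) (l ⊕ l) k}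
    (hh : ∀ x y, sform l k (h *ᵥ x) (h *ᵥ y) = sform l k x y) : h ∈ symplecticGroup l k := by
  rw [SymplecticGroup.mem_iff']
  refine (Matrix.toLinearMap₂' k : Matrix (l ⊕ l) (l ⊕ l) k ≃ₗ[k]
    (l ⊕ l → k) →ₗ[k] (l ⊕ l → k) →ₗ[k] k).injective ?_
  refine LinearMap.ext fun x => LinearMap.ext fun y => ?_
  have := hh x y
  rw [sform_apply, sform_apply] at this
  rw [Matrix.toLinearMap₂'_apply', Matrix.toLinearMap₂'_apply', ← this, ← Matrix.mulVec_mulVec,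
    ← Matrix.mulVec_mulVec, Matrix.dotProduct_mulVec x, Matrix.vecMul_transpose]

/-- Every linear functional is represented by the symplectic form. -/
theorem exists_sform_eq [CommRing k] (f : (l ⊕ l → k) →ₗ[k] k) :
    ∃ w, ∀ x, sform l k x w = f x := by
  refine ⟨-(J l k *ᵥ fun i => f (Pi.single i 1)), fun x => ?_⟩
  rw [sform_apply, Matrix.mulVec_neg, Matrix.mulVec_mulVec, J_squared]
  simp only [Matrix.neg_mulVec, Matrix.one_mulVec, neg_neg, dotProduct]
  conv_rhs => rw [← LinearMap.sum_single_apply (fun _ => k) x]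
  rw [map_sum]
  refine Finset.sum_congr rfl fun i _ => ?_
  rw [show Pi.single i (x i) = x i • (Pi.single i 1 : l ⊕ l → k) by
    rw [← Pi.single_smul]; simp]
  simp

/-- Two linear functionals that do not vanish have a common non-zero. -/
theorem exists_both_ne_zero {E : Type*} [CommRing k] [AddCommGroup E] [Module k E]
    (f g : E →ₗ[k] k) {a b : E} (ha : f a ≠ 0) (hb : g b ≠ 0) : ∃ c ∈ Submodule.span k {a, b},
      f c ≠ 0 ∧ g c ≠ 0 := by
  have hA : a ∈ Submodule.span k {a, b} := Submodule.subset_span (by simp)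
  have hB : b ∈ Submodule.span k {a, b} := Submodule.subset_span (by simp)
  by_cases h1 : g a = 0
  · by_cases h2 : f b = 0
    · exact ⟨a + b, add_mem hA hB, by simpa [h2] using ha, by simpa [h1] using hb⟩
    · exact ⟨b, hB, h2, hb⟩
  · exact ⟨a, hA, ha, h1⟩

/-- The symplectic transvection `x ↦ x + c B(x, u) u`. -/
theorem exists_transvection [CommRing k] (c : k) (u : l ⊕ l → k) :
    ∃ h ∈ symplecticGroup l k, ∀ x, h *ᵥ x = x + (c * sform l k x u) • u := by
  let T : (l ⊕ l → k) →ₗ[k] (l ⊕ l → k) :=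
    LinearMap.id + c • ((sform l k).flip u).smulRight u
  have hT : ∀ x, LinearMap.toMatrix' T *ᵥ x = x + (c * sform l k x u) • u := fun x => by
    rw [← Matrix.toLin'_apply, Matrix.toLin'_toMatrix']
    simp [T, mul_smul]
  refine ⟨LinearMap.toMatrix' T, mem_symplecticGroup_of_sform fun x y => ?_, hT⟩
  rw [hT, hT]
  simp only [map_add, map_smul, LinearMap.add_apply, LinearMap.smul_apply, smul_eq_mul, sform_self,
    sform_neg u y]
  ring

variable [Field k]

/-- If `B(x, y) ≠ 0`, a transvection moves `x` to `y` and fixes `(y - x)^⊥`. -/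
theorem exists_symplectic_map_of_ne {x y : l ⊕ l → k} (hxy : sform l k x y ≠ 0) :
    ∃ h ∈ symplecticGroup l k, h *ᵥ x = y ∧ ∀ z, sform l k z x = sform l k z y → h *ᵥ z = z := by
  obtain ⟨h, hh, hT⟩ := exists_transvection (sform l k x y)⁻¹ (y - x)
  refine ⟨h, hh, ?_, fun z hz => ?_⟩
  · rw [hT, map_sub, sform_self, sub_zero, inv_mul_cancel₀ hxy, one_smul, add_sub_cancel]
  · rw [hT, map_sub, hz, sub_self, mul_zero, zero_smul, add_zero]

/-- Separating a vector from a subspace by the symplectic form. -/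
theorem exists_sform_ne_zero {R : Submodule k (l ⊕ l → k)} {x : l ⊕ l → k} (hx : x ∉ R) :
    ∃ w, (∀ r ∈ R, sform l k r w = 0) ∧ sform l k x w ≠ 0 := by
  obtain ⟨f, hfx, hf⟩ := Submodule.exists_le_ker_of_notMem hx
  obtain ⟨w, hw⟩ := exists_sform_eq f
  exact ⟨w, fun r hr => by rw [hw]; exact hf hr, by rwa [hw]⟩

/-- The inductive step of Witt's theorem. If `B(x, y) ≠ 0`, the transvection along `y - x` works,
because `R` is orthogonal to `y - x`. Otherwise two transvections are composed through `x + w`,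
where `w ∈ R^⊥` is orthogonal to neither `x` nor `y`; such a `w` exists because `x` and `y` lie
outside `R`. -/
theorem exists_symplectic_map_fixing {R : Submodule k (l ⊕ l → k)} {x y : l ⊕ l → k} (hx : x ∉ R)
    (hy : y ∉ R) (hxy : ∀ r ∈ R, sform l k r x = sform l k r y) :
    ∃ h ∈ symplecticGroup l k, h *ᵥ x = y ∧ ∀ r ∈ R, h *ᵥ r = r := by
  by_cases hB : sform l k x y = 0
  · obtain ⟨a, haR, ha⟩ := exists_sform_ne_zero hx
    obtain ⟨b, hbR, hb⟩ := exists_sform_ne_zero hy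
    obtain ⟨w, hw, hxw, hyw⟩ := exists_both_ne_zero (sform l k x) (sform l k y) ha hb
    have hwR : ∀ r ∈ R, sform l k r w = 0 := fun r hr => by
      have : Submodule.span k {a, b} ≤ LinearMap.ker (sform l k r) := by
        rw [Submodule.span_le]
        rintro c (rfl | rfl)
        · exact haR r hr
        · exact hbR r hr
      exact this hw
    obtain ⟨h, hh, h1, h2⟩ := exists_symplectic_map_of_ne (x := x) (y := x + w)
      (by rwa [map_add, sform_self, zero_add])
    obtain ⟨g, hg, g1, g2⟩ := exists_symplectic_map_of_ne (x := x + w) (y := y) (by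
      rw [sform_neg, map_add, sform_neg y x, hB, neg_zero, zero_add]
      exact neg_ne_zero.mpr hyw)
    refine ⟨g * h, mul_mem hg hh, by rw [← Matrix.mulVec_mulVec, h1, g1], fun r hr => ?_⟩
    have hr' : sform l k r (x + w) = sform l k r x := by rw [map_add, hwR r hr, add_zero]
    rw [← Matrix.mulVec_mulVec, h2 r hr'.symm, g2 r (hr'.trans (hxy r hr))]
  · obtain ⟨h, hh, h1, h2⟩ := exists_symplectic_map_of_ne hB
    exact ⟨h, hh, h1, fun r hr => h2 r (hxy r hr)⟩

/-- Witt's theorem for families of vectors in a symplectic space. -/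
theorem exists_symplectic_of_gram_eq {ι : Type*} [Fintype ι] (v w : ι → l ⊕ l → k)
    (hrel : ∀ a : ι → k, ∑ i, a i • v i = 0 ↔ ∑ i, a i • w i = 0)
    (hgram : ∀ i j, sform l k (v i) (v j) = sform l k (w i) (w j)) :
    ∃ h ∈ symplecticGroup l k, ∀ i, h *ᵥ v i = w i := by
  classical
  suffices H : ∀ s : Finset ι, ∃ h ∈ symplecticGroup l k, ∀ i ∈ s, h *ᵥ v i = w i by
    obtain ⟨h, hh, H'⟩ := H Finset.univ
    exact ⟨h, hh, fun i => H' i (Finset.mem_univ i)⟩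
  -- A family satisfying all the relations of another one also inherits its expressions of one
  -- vector through others.
  have hspan : ∀ (u u' : ι → l ⊕ l → k), (∀ a : ι → k, ∑ i, a i • u i = 0 → ∑ i, a i • u' i = 0) →
      ∀ (s : Finset ι) (j : ι), j ∉ s → u j ∈ Submodule.span k (u '' s) →
      ∃ a : ι → k, u j = ∑ i ∈ s, a i • u i ∧ u' j = ∑ i ∈ s, a i • u' i := by
    intro u u' huu s j hj hmem
    obtain ⟨a, ha⟩ := (Submodule.mem_span_image_finset_iff_exists_fun' k).mp hmem
    refine ⟨a, ha.symm, ?_⟩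
    have hsum : ∀ t : ι → l ⊕ l → k,
        ∑ i, (if i = j then (-1 : k) else if i ∈ s then a i else 0) • t i =
          (∑ i ∈ s, a i • t i) - t j := by
      intro t
      rw [← Finset.add_sum_erase _ _ (Finset.mem_univ j), if_pos rfl, neg_one_smul,
        neg_add_eq_sub]
      congr 1
      rw [← Finset.sum_subset (Finset.subset_erase.mpr ⟨Finset.subset_univ s, hj⟩)]
      · refine Finset.sum_congr rfl fun i hi => ?_
        rw [if_neg (by rintro rfl; exact hj hi), if_pos hi]
      · intro i hi his
        rw [if_neg (Finset.ne_of_mem_erase hi), if_neg his, zero_smul]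
    have := huu _ ((hsum u).trans (by rw [ha, sub_self]))
    rw [hsum u'] at this
    exact (sub_eq_zero.mp this).symm
  intro s
  induction s using Finset.induction_on with
  | empty => exact ⟨1, one_mem _, by simp⟩
  | insert j s hj ih =>
    obtain ⟨h, hh, hs⟩ := ih
    -- A dependent vector is already mapped correctly by linearity. For an independent one, `h` is
    -- corrected by a map that fixes the earlier images and sends `h v_j` to `w_j`.
    by_cases hx : w j ∈ Submodule.span k (w '' s)
    · obtain ⟨a, ha, ha'⟩ := hspan w v (fun a => (hrel a).2) s j hj hx
      refine ⟨h, hh, fun i hi => ?_⟩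
      rcases Finset.mem_insert.mp hi with rfl | hi
      · rw [ha, ha', Matrix.mulVec_sum]
        exact Finset.sum_congr rfl fun i hi => by rw [Matrix.mulVec_smul, hs i hi]
      · exact hs i hi
    · have himg : w '' s = (fun i => h *ᵥ v i) '' s :=
        Set.image_congr fun i hi => (hs i hi).symm
      have hhrel : ∀ a : ι → k, ∑ i, a i • (h *ᵥ v i) = h *ᵥ ∑ i, a i • v i := fun a => by
        rw [Matrix.mulVec_sum]
        exact Finset.sum_congr rfl fun i _ => by rw [Matrix.mulVec_smul]
      have hvx : h *ᵥ v j ∉ Submodule.span k (w '' s) := by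
        intro hmem
        rw [himg] at hmem
        obtain ⟨a, ha, ha'⟩ := hspan (fun i => h *ᵥ v i) w (fun a h0 => by
          rw [← hrel]
          rw [hhrel] at h0
          have hu := SymplecticGroup.symplectic_det hh
          have := congrArg (fun z => h⁻¹ *ᵥ z) h0
          simpa [Matrix.mulVec_mulVec, Matrix.nonsing_inv_mul _ hu] using this) s j hj hmem
        refine hx ?_
        rw [ha']
        exact Submodule.sum_mem _ fun i hi => Submodule.smul_mem _ _
          (Submodule.subset_span ⟨i, hi, rfl⟩)
      obtain ⟨g, hg, g1, g2⟩ := exists_symplectic_map_fixing hvx hx (by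
        intro r hr
        have hle : Submodule.span k (w '' s) ≤ LinearMap.ker
            ((sform l k).flip (h *ᵥ v j) - (sform l k).flip (w j)) := by
          rw [Submodule.span_le]
          rintro _ ⟨i, hi, rfl⟩
          simp only [SetLike.mem_coe, LinearMap.mem_ker, LinearMap.sub_apply, LinearMap.flip_apply]
          rw [← hgram, ← hs i hi, mulVec_sform hh, sub_self]
        have := hle hr
        simpa [sub_eq_zero] using this)
      refine ⟨g * h, mul_mem hg hh, fun i hi => ?_⟩
      rw [← Matrix.mulVec_mulVec]
      rcases Finset.mem_insert.mp hi with rfl | hi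
      · exact g1
      · rw [hs i hi]
        exact g2 _ (Submodule.subset_span ⟨i, hi, rfl⟩)

end Form

/-! ### Tensors as matrices, orbits and Gram matrices -/

section Action

variable {k : Type*} {m : ℕ}

/-- A tensor in `W_4 ⊗ W_{2m}`, as a `4 × 2m` matrix. -/
def toMat (v : V k m) : Matrix (Idx 2) (Idx m) k := Matrix.of fun i j => v (i, j)

/-- The tensor in `W_4 ⊗ W_{2m}` with a given `4 × 2m` matrix. -/
def ofMat (M : Matrix (Idx 2) (Idx m) k) : V k m := fun p => M p.1 p.2

@[simp] theorem toMat_ofMat (M : Matrix (Idx 2) (Idx m) k) : toMat (ofMat M) = M := rfl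

@[simp] theorem ofMat_toMat (v : V k m) : ofMat (toMat v) = v := rfl

@[simp] theorem toMat_smul [CommRing k] (c : k) (v : V k m) : toMat (c • v) = c • toMat v := rfl

@[simp] theorem ofMat_smul [CommRing k] (c : k) (M : Matrix (Idx 2) (Idx m) k) :
    ofMat (c • M) = c • ofMat M := rfl

theorem ofMat_ne_zero [CommRing k] {M : Matrix (Idx 2) (Idx m) k} (hM : M ≠ 0) : ofMat M ≠ 0 :=
  fun h => hM (by rw [← toMat_ofMat M, h]; rfl)

theorem kronecker_mulVec_eq [CommRing k] (g : Matrix (Idx 2) (Idx 2) k)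
    (h : Matrix (Idx m) (Idx m) k) (v : V k m) : (g ⊗ₖ h) *ᵥ v = ofMat (g * toMat v * hᵀ) := by
  funext p
  simp only [Matrix.mulVec, dotProduct, ofMat, Matrix.mul_apply, Matrix.transpose_apply,
    Fintype.sum_prod_type, Matrix.kroneckerMap_apply, toMat, Matrix.of_apply, Finset.sum_mul]
  rw [Finset.sum_comm]
  exact Finset.sum_congr rfl fun i _ => Finset.sum_congr rfl fun j _ => by ring

@[simp] theorem coe_tensorHom [CommRing k] (p : Sp k 2 × Sp k m) :
    (tensorHom k m p : Matrix (Idx 2 × Idx m) (Idx 2 × Idx m) k) =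
      (p.1 : Matrix (Idx 2) (Idx 2) k) ⊗ₖ (p.2 : Matrix (Idx m) (Idx m) k) := rfl

theorem tensorHom_smul [Field k] (p : Sp k 2 × Sp k m) (v : V k m) :
    tensorHom k m p • v =
      ofMat ((p.1 : Matrix (Idx 2) (Idx 2) k) * toMat v * (p.2 : Matrix (Idx m) (Idx m) k)ᵀ) :=
  kronecker_mulVec_eq _ _ v

/-- The Gram matrix of the rows of a `4 × 2m` matrix. -/
def gram [CommRing k] (M : Matrix (Idx 2) (Idx m) k) : Matrix (Idx 2) (Idx 2) k := M * J (Fin m) k * Mᵀ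

variable [Field k]

/-- Matrices that agree up to a non-zero scalar and the action of `Sp_4 × Sp_{2m}`. -/
def SameOrbit (M M' : Matrix (Idx 2) (Idx m) k) : Prop :=
  ∃ c : k, c ≠ 0 ∧ ∃ g ∈ symplecticGroup (Fin 2) k, ∃ h ∈ symplecticGroup (Fin m) k,
    M' = c • (g * M * hᵀ)

theorem mem_orbit_iff {v w : V k m} (hv : v ≠ 0) (hw : w ≠ 0) :
    Projectivization.mk k w hw ∈ orbit (Projectivization.mk k v hv) ↔
      SameOrbit (toMat v) (toMat w) := by
  constructor
  · rintro ⟨⟨_, p, rfl⟩, h⟩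
    have h' : Projectivization.mk k (tensorHom k m p • v)
        ((smul_ne_zero_iff_ne _).mpr hv) = Projectivization.mk k w hw := h
    rw [Projectivization.mk_eq_mk_iff'] at h'
    obtain ⟨a, ha⟩ := h'
    have ha0 : a ≠ 0 := by
      rintro rfl
      rw [zero_smul] at ha
      exact ((smul_ne_zero_iff_ne _).mpr hv) ha.symm
    refine ⟨a⁻¹, inv_ne_zero ha0, _, p.1.2, _, p.2.2, ?_⟩
    have h2 := congrArg toMat (tensorHom_smul p v)
    rw [toMat_ofMat] at h2
    rw [← h2, ← ha, toMat_smul, inv_smul_smul₀ ha0]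
  · rintro ⟨c, hc, g, hg, h, hh, H⟩
    refine ⟨⟨_, (⟨g, hg⟩, ⟨h, hh⟩), rfl⟩, ?_⟩
    change Projectivization.mk k (tensorHom k m (⟨g, hg⟩, ⟨h, hh⟩) • v)
        ((smul_ne_zero_iff_ne _).mpr hv) = Projectivization.mk k w hw
    rw [Projectivization.mk_eq_mk_iff']
    refine ⟨c⁻¹, ?_⟩
    rw [tensorHom_smul, ← ofMat_toMat w, H, ofMat_smul, inv_smul_smul₀ hc]

theorem SameOrbit.trans {M M' M'' : Matrix (Idx 2) (Idx m) k} (h : SameOrbit M M')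
    (h' : SameOrbit M' M'') : SameOrbit M M'' := by
  obtain ⟨c, hc, g, hg, h, hh, rfl⟩ := h
  obtain ⟨c', hc', g', hg', h', hh', rfl⟩ := h'
  refine ⟨c' * c, mul_ne_zero hc' hc, g' * g, mul_mem hg' hg, h' * h, mul_mem hh' hh, ?_⟩
  simp only [Matrix.transpose_mul, Matrix.mul_assoc, Matrix.mul_smul, Matrix.smul_mul, smul_smul]

theorem SameOrbit.symm {M M' : Matrix (Idx 2) (Idx m) k} (h : SameOrbit M M') :
    SameOrbit M' M := by
  obtain ⟨c, hc, g, hg, h, hh, rfl⟩ := h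
  have hgu := SymplecticGroup.symplectic_det hg
  have hhu : IsUnit hᵀ.det := by
    rw [Matrix.det_transpose]; exact SymplecticGroup.symplectic_det hh
  refine ⟨c⁻¹, inv_ne_zero hc, g⁻¹, ?_, h⁻¹, ?_, ?_⟩
  · rw [← SymplecticGroup.coe_inv' ⟨g, hg⟩]; exact Subtype.property _
  · rw [← SymplecticGroup.coe_inv' ⟨h, hh⟩]; exact Subtype.property _
  · rw [Matrix.transpose_nonsing_inv, Matrix.mul_smul, Matrix.smul_mul, smul_smul,
      inv_mul_cancel₀ hc, one_smul, Matrix.mul_assoc g, Matrix.nonsing_inv_mul_cancel_left _ _ hgu,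
      Matrix.mul_nonsing_inv_cancel_right _ _ hhu]

theorem orbit_eq_of_sameOrbit {v w : V k m} (hv : v ≠ 0) (hw : w ≠ 0)
    (h : SameOrbit (toMat v) (toMat w)) :
    orbit (Projectivization.mk k v hv) = orbit (Projectivization.mk k w hw) :=
  (MulAction.orbit_eq_iff.mpr ((mem_orbit_iff hv hw).mpr h)).symm

theorem gram_apply (M : Matrix (Idx 2) (Idx m) k) (i j : Idx 2) :
    gram M i j = sform (Fin m) k (M i) (M j) := by
  rw [sform_apply, gram, Matrix.mul_assoc, Matrix.mul_apply_eq_vecMul, Matrix.vecMul]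
  rfl

theorem gram_mul (g : Matrix (Idx 2) (Idx 2) k) (M : Matrix (Idx 2) (Idx m) k) :
    gram (g * M) = g * gram M * gᵀ := by
  simp only [gram, Matrix.transpose_mul, Matrix.mul_assoc]

theorem gram_smul (c : k) (M : Matrix (Idx 2) (Idx m) k) : gram (c • M) = c ^ 2 • gram M := by
  simp only [gram, Matrix.transpose_smul, Matrix.mul_smul, Matrix.smul_mul, smul_smul, sq]

theorem gram_mul_symplectic (M : Matrix (Idx 2) (Idx m) k) {h : Matrix (Idx m) (Idx m) k}
    (hh : h ∈ symplecticGroup (Fin m) k) : gram (M * hᵀ) = gram M := by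
  rw [← SymplecticGroup.transpose_mem_iff, SymplecticGroup.mem_iff] at hh
  rw [gram, gram, Matrix.transpose_mul, ← Matrix.mul_assoc, Matrix.mul_assoc M,
    Matrix.mul_assoc M, hh]

/-- This turns singularity into a linear condition on the Gram matrix, valid in every
characteristic. -/
theorem Q_eq_gram (v : V k m) : Q v = -(gram (toMat v) (Sum.inl 0) (Sum.inr 0) +
    gram (toMat v) (Sum.inl 1) (Sum.inr 1)) := by
  simp only [gram_apply, sform_eq_sum, Q, Fin.sum_univ_two, ← Finset.sum_add_distrib,
    ← Finset.sum_neg_distrib, toMat, Matrix.of_apply]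
  exact Finset.sum_congr rfl fun i _ => by ring

/-- Up to `Sp_4`, a scalar and `Sp_{2m}`, a matrix is determined by the linear relations between
its rows and by their Gram matrix. -/
def IsOfType (K : Submodule k (Idx 2 → k)) (N : Matrix (Idx 2) (Idx 2) k)
    (M : Matrix (Idx 2) (Idx m) k) : Prop :=
  ∃ c : k, c ≠ 0 ∧ ∃ g ∈ symplecticGroup (Fin 2) k, gram (c • (g * M)) = N ∧
    ∀ a, a ᵥ* (g * M) = 0 ↔ a ∈ K

theorem vecMul_eq_sum_smul (a : Idx 2 → k) (M : Matrix (Idx 2) (Idx m) k) :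
    ∑ i, a i • M i = a ᵥ* M := by
  funext j
  simp [Matrix.vecMul, dotProduct, Finset.sum_apply]

/-- After normalising by `Sp_4` and a scalar, the two families of rows have the same relations and
the same Gram matrix, so Witt's theorem in `W_{2m}` matches them. -/
theorem IsOfType.sameOrbit {K : Submodule k (Idx 2 → k)} {N : Matrix (Idx 2) (Idx 2) k}
    {M M' : Matrix (Idx 2) (Idx m) k} (h : IsOfType K N M) (h' : IsOfType K N M') :
    SameOrbit M M' := by
  obtain ⟨c, hc, g, hg, hN, hK⟩ := h
  obtain ⟨c', hc', g', hg', hN', hK'⟩ := h'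
  have h1 : SameOrbit M (c • (g * M)) := ⟨c, hc, g, hg, 1, one_mem _, by simp⟩
  have h2 : SameOrbit M' (c' • (g' * M')) := ⟨c', hc', g', hg', 1, one_mem _, by simp⟩
  refine h1.trans (SameOrbit.trans ?_ h2.symm)
  obtain ⟨h, hh, H⟩ := exists_symplectic_of_gram_eq (c • (g * M)) (c' • (g' * M'))
    (fun a => by
      rw [vecMul_eq_sum_smul, vecMul_eq_sum_smul, Matrix.vecMul_smul, Matrix.vecMul_smul,
        smul_eq_zero_iff_right hc, smul_eq_zero_iff_right hc', hK, hK'])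
    (fun i j => by rw [← gram_apply, ← gram_apply, hN, hN'])
  refine ⟨1, one_ne_zero, 1, one_mem _, h, hh, ?_⟩
  rw [one_smul, Matrix.one_mul]
  funext i
  rw [← H i, Matrix.mul_apply_eq_vecMul, Matrix.vecMul_transpose]

end Action

/-! ### Normal forms of traceless alternating forms on the 4-space -/

section Rows

variable {k : Type*}

/-- The matrix with given rows. -/
def rowMat (x z u y : Idx 2 → k) : Matrix (Idx 2) (Idx 2) k := Sum.elim ![x, z] ![u, y]

@[simp] theorem rowMat_inl_zero (x z u y : Idx 2 → k) : rowMat x z u y (Sum.inl 0) = x := rfl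

@[simp] theorem rowMat_inl_one (x z u y : Idx 2 → k) : rowMat x z u y (Sum.inl 1) = z := rfl

@[simp] theorem rowMat_inr_zero (x z u y : Idx 2 → k) : rowMat x z u y (Sum.inr 0) = u := rfl

@[simp] theorem rowMat_inr_one (x z u y : Idx 2 → k) : rowMat x z u y (Sum.inr 1) = y := rfl

end Rows

section NormalForm

variable {k : Type*} [Field k]

/-- Alternating forms on `W_4` whose contraction with the symplectic form is zero. -/
structure IsTracelessAlt (N : Matrix (Idx 2) (Idx 2) k) : Prop where
  diag : ∀ i, N i i = 0
  skew : ∀ i j, N i j = - N j i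
  contract : N (Sum.inl 0) (Sum.inr 0) + N (Sum.inl 1) (Sum.inr 1) = 0

theorem isTracelessAlt_gram {m : ℕ} {v : V k m} (hv : Q v = 0) :
    IsTracelessAlt (gram (toMat v)) where
  diag i := by rw [gram_apply, sform_self]
  skew i j := by rw [gram_apply, gram_apply, sform_neg]
  contract := by rwa [Q_eq_gram, neg_eq_zero] at hv

/-- The endomorphism `T` with `B(T a, b) = aᵀ N b`. -/
noncomputable def formEnd (N : Matrix (Idx 2) (Idx 2) k) :
    (Idx 2 → k) →ₗ[k] (Idx 2 → k) := Matrix.toLin' (-(J (Fin 2) k * N))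

theorem formEnd_apply (N : Matrix (Idx 2) (Idx 2) k) (a : Idx 2 → k) :
    formEnd N a = -(J (Fin 2) k * N) *ᵥ a := rfl

theorem sform_formEnd_right (N : Matrix (Idx 2) (Idx 2) k) (a b : Idx 2 → k) :
    sform (Fin 2) k a (formEnd N b) = a ⬝ᵥ N *ᵥ b := by
  rw [sform_apply, formEnd_apply, Matrix.mulVec_mulVec, Matrix.mul_neg, ← Matrix.mul_assoc,
    J_squared]
  simp

variable {N : Matrix (Idx 2) (Idx 2) k}

theorem IsTracelessAlt.transpose (hN : IsTracelessAlt N) : Nᵀ = -N := by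
  ext i j
  exact hN.skew j i

theorem IsTracelessAlt.dotProduct_self (hN : IsTracelessAlt N) (a : Idx 2 → k) :
    a ⬝ᵥ N *ᵥ a = 0 := by
  simp only [dotProduct, Matrix.mulVec, Fintype.sum_sum_type, Fin.sum_univ_two, hN.diag]
  rw [hN.skew (Sum.inl 1) (Sum.inl 0), hN.skew (Sum.inr 0) (Sum.inl 0),
    hN.skew (Sum.inr 1) (Sum.inl 0), hN.skew (Sum.inr 0) (Sum.inl 1),
    hN.skew (Sum.inr 1) (Sum.inl 1), hN.skew (Sum.inr 1) (Sum.inr 0)]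
  ring

theorem IsTracelessAlt.dotProduct_comm (hN : IsTracelessAlt N) (a b : Idx 2 → k) :
    a ⬝ᵥ N *ᵥ b = -(b ⬝ᵥ N *ᵥ a) := by
  rw [Matrix.dotProduct_mulVec, ← Matrix.mulVec_transpose, hN.transpose, _root_.dotProduct_comm]
  simp [Matrix.neg_mulVec]

theorem sform_formEnd_left (hN : IsTracelessAlt N) (a b : Idx 2 → k) :
    sform (Fin 2) k (formEnd N a) b = a ⬝ᵥ N *ᵥ b := by
  rw [sform_neg, sform_formEnd_right, hN.dotProduct_comm a b]

/-- The Pfaffian of a traceless alternating form. -/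
def pf (N : Matrix (Idx 2) (Idx 2) k) : k :=
  N (Sum.inl 0) (Sum.inl 1) * N (Sum.inr 0) (Sum.inr 1) + N (Sum.inl 0) (Sum.inr 0) ^ 2 +
    N (Sum.inl 0) (Sum.inr 1) * N (Sum.inl 1) (Sum.inr 0)

/-- An endomorphism of a symplectic 4-space coming from an alternating form is a root of a quadratic
Pfaffian characteristic polynomial. Its linear coefficient is, up to sign, the contraction of `N`,
which vanishes here. The proof checks all entries. -/
theorem J_mul_sq (hN : IsTracelessAlt N) : (J (Fin 2) k * N) * (J (Fin 2) k * N) = pf N • 1 := by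
  have h := hN.contract
  have h1 : N (Sum.inl 1) (Sum.inr 1) = - N (Sum.inl 0) (Sum.inr 0) := by linear_combination h
  have e := hN.skew
  have d := hN.diag
  have JN : J (Fin 2) k * N = Matrix.of (fun i j => Sum.elim (fun i => - N (Sum.inr i) j)
      (fun i => N (Sum.inl i) j) i) := by
    ext i j
    rcases i with i | i <;>
      simp [J, Matrix.mul_apply, Fintype.sum_sum_type, Matrix.one_apply]
  rw [JN]
  ext i j
  rcases i with i | i <;> rcases j with j | j <;> fin_cases i <;> fin_cases j <;>
    simp [Matrix.mul_apply, Fintype.sum_sum_type, Fin.sum_univ_two, pf, d, h1,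
      e (Sum.inl 1) (Sum.inl 0), e (Sum.inr 0) (Sum.inl 0), e (Sum.inr 1) (Sum.inl 0),
      e (Sum.inr 0) (Sum.inl 1), e (Sum.inr 1) (Sum.inl 1), e (Sum.inr 1) (Sum.inr 0)] <;> ring

theorem formEnd_formEnd (hN : IsTracelessAlt N) (a : Idx 2 → k) :
    formEnd N (formEnd N a) = pf N • a := by
  rw [formEnd_apply, formEnd_apply, Matrix.mulVec_mulVec, neg_mul_neg, J_mul_sq hN,
    Matrix.smul_mulVec, Matrix.one_mulVec]

theorem pf_ne_zero (hN : IsTracelessAlt N) (h : N.det ≠ 0) : pf N ≠ 0 := by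
  intro h0
  have := congrArg Matrix.det (J_mul_sq hN)
  rw [h0, zero_smul, Matrix.det_zero, Matrix.det_mul, Matrix.det_mul] at this
  exact (mul_ne_zero (isUnit_det_J _ _).ne_zero h) (mul_self_eq_zero.mp this)

theorem pf_eq_zero (hN : IsTracelessAlt N) (h : N.det = 0) : pf N = 0 := by
  have := congrArg Matrix.det (J_mul_sq hN)
  rw [Matrix.det_mul, Matrix.det_mul, h, Matrix.det_smul, Matrix.det_one] at this
  simpa using this.symm

/-- A vector with prescribed products with two independent vectors. -/
theorem exists_sform_eq_pair {x z : Idx 2 → k} (h : LinearIndependent k ![x, z]) (a b : k) :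
    ∃ y, sform (Fin 2) k x y = a ∧ sform (Fin 2) k z y = b := by
  obtain ⟨f, hf⟩ : ∃ f : (Idx 2 → k) →ₗ[k] k, f x = a ∧ f z = b := by
    obtain ⟨g, hg⟩ := LinearMap.exists_extend
      ((Module.Basis.span h).constr k ![a, b] : _ →ₗ[k] k)
    refine ⟨g, ?_, ?_⟩
    · have h1 := LinearMap.congr_fun hg (Module.Basis.span h 0)
      rwa [Module.Basis.constr_basis, LinearMap.comp_apply, Submodule.subtype_apply,
        Module.Basis.span_apply] at h1
    · have h1 := LinearMap.congr_fun hg (Module.Basis.span h 1)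
      rwa [Module.Basis.constr_basis, LinearMap.comp_apply, Submodule.subtype_apply,
        Module.Basis.span_apply] at h1
  obtain ⟨y, hy⟩ := exists_sform_eq f
  exact ⟨y, by rw [hy, hf.1], by rw [hy, hf.2]⟩

/-- The non-degenerate normal form. -/
def genForm (k : Type*) [Field k] : Matrix (Idx 2) (Idx 2) k :=
  fromBlocks 0 (-!![0, 1; 1, 0]) !![0, 1; 1, 0] 0

/-- The degenerate normal form. -/
def degForm (k : Type*) [Field k] : Matrix (Idx 2) (Idx 2) k :=
  fromBlocks 0 (-!![0, 1; 0, 0]) !![0, 0; 1, 0] 0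

theorem mul_mul_transpose_apply (g A : Matrix (Idx 2) (Idx 2) k) (i j : Idx 2) :
    (g * A * gᵀ) i j = g i ⬝ᵥ A *ᵥ g j := by
  rw [Matrix.mul_assoc, Matrix.mul_apply_eq_vecMul, Matrix.vecMul]
  rfl

theorem mem_symplectic_of_rows (x z u y : Idx 2 → k)
    (h1 : sform (Fin 2) k x z = 0) (h2 : sform (Fin 2) k x u = -1) (h3 : sform (Fin 2) k x y = 0)
    (h4 : sform (Fin 2) k z u = 0) (h5 : sform (Fin 2) k z y = -1)
    (h6 : sform (Fin 2) k u y = 0) :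
    rowMat x z u y ∈ symplecticGroup (Fin 2) k := by
  rw [SymplecticGroup.mem_iff]
  ext i j
  rw [mul_mul_transpose_apply, ← sform_apply]
  rcases i with i | i <;> rcases j with j | j <;> fin_cases i <;> fin_cases j <;>
    simp [J, sform_self, h1, h2, h3, h4, h5, h6, sform_neg z x, sform_neg u x, sform_neg y x,
      sform_neg u z, sform_neg y z, sform_neg y u]

/-- With `T = formEnd N`, `T² = 1`. Choose `y` with `B(x, y) = -1` and `B(T x, y) = 0`. Since `T` is
self-adjoint and `B(a, T a) = 0`, the rows `x, T x, y, T y` form a symplectic basis, in which `N` is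
read off from the action of `T`. -/
theorem exists_genForm (hN : IsTracelessAlt N) (hp : pf N = 1) {x : Idx 2 → k}
    (hx : LinearIndependent k ![x, formEnd N x]) :
    ∃ g ∈ symplecticGroup (Fin 2) k, g * N * gᵀ = genForm k := by
  obtain ⟨y, hy, hy'⟩ := exists_sform_eq_pair hx (-1) 0
  have self : ∀ a, sform (Fin 2) k a (formEnd N a) = 0 := fun a => by
    rw [sform_formEnd_right, hN.dotProduct_self]
  have adj : ∀ a b, sform (Fin 2) k a (formEnd N b) = sform (Fin 2) k (formEnd N a) b :=
    fun a b => by rw [sform_formEnd_right, sform_formEnd_left hN]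
  have TT : ∀ a, formEnd N (formEnd N a) = a := fun a => by rw [formEnd_formEnd hN, hp, one_smul]
  have self' : ∀ a, sform (Fin 2) k (formEnd N a) a = 0 := fun a => by
    rw [sform_neg, self, neg_zero]
  have hyx : sform (Fin 2) k y x = 1 := by rw [sform_neg, hy, neg_neg]
  have hTyx : sform (Fin 2) k (formEnd N y) x = 0 := by rw [← adj, sform_neg, hy', neg_zero]
  refine ⟨_, mem_symplectic_of_rows x (formEnd N x) y (formEnd N y) (self x) hy
    (by rw [adj, hy']) hy' (by rw [← adj, TT, hy]) (self y), ?_⟩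
  ext i j
  rw [mul_mul_transpose_apply, ← sform_formEnd_right]
  rcases i with i | i <;> rcases j with j | j <;> fin_cases i <;> fin_cases j <;>
    simp [genForm, self', TT, sform_self, hy, hy', adj, hyx, hTyx]

/-- Now `T² = 0`, and the symplectic basis is `x, T x, T y, y` with `B(x, y) = 0` and `B(T x, y) =
-1`. The shape of the rows is recorded because the second row `T x` will later be chosen to be a
relation between the rows of the tensor. -/
theorem exists_degForm (hN : IsTracelessAlt N) (hp : pf N = 0) {x : Idx 2 → k}
    (hx : formEnd N x ≠ 0) :
    ∃ g ∈ symplecticGroup (Fin 2) k, g * N * gᵀ = degForm k ∧ g (Sum.inl 0) = x ∧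
      g (Sum.inl 1) = formEnd N x ∧ g (Sum.inr 0) = formEnd N (g (Sum.inr 1)) := by
  have TT : ∀ a, formEnd N (formEnd N a) = 0 := fun a => by rw [formEnd_formEnd hN, hp, zero_smul]
  have hli : LinearIndependent k ![x, formEnd N x] := by
    rw [LinearIndependent.pair_iff]
    intro s t h
    have h1 := congrArg (formEnd N) h
    simp only [map_add, map_smul, TT, smul_zero, add_zero, map_zero, smul_eq_zero, hx,
      or_false] at h1
    rw [h1, zero_smul, zero_add] at h
    exact ⟨h1, (smul_eq_zero.mp h).resolve_right hx⟩
  obtain ⟨y, hy, hy'⟩ := exists_sform_eq_pair hli 0 (-1)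
  have self : ∀ a, sform (Fin 2) k a (formEnd N a) = 0 := fun a => by
    rw [sform_formEnd_right, hN.dotProduct_self]
  have adj : ∀ a b, sform (Fin 2) k a (formEnd N b) = sform (Fin 2) k (formEnd N a) b :=
    fun a b => by rw [sform_formEnd_right, sform_formEnd_left hN]
  have self' : ∀ a, sform (Fin 2) k (formEnd N a) a = 0 := fun a => by
    rw [sform_neg, self, neg_zero]
  have hTyx : sform (Fin 2) k (formEnd N y) x = 1 := by rw [← adj, sform_neg, hy', neg_neg]
  refine ⟨_, mem_symplectic_of_rows x (formEnd N x) (formEnd N y) y (self x)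
    (by rw [adj, hy']) hy (by rw [adj, TT]; simp) hy' (by rw [sform_neg, self, neg_zero]),
    ?_, rfl, rfl, rfl⟩
  ext i j
  rw [mul_mul_transpose_apply, ← sform_formEnd_right]
  rcases i with i | i <;> rcases j with j | j <;> fin_cases i <;> fin_cases j <;>
    simp [degForm, self', TT, hy', adj, hTyx]

end NormalForm

/-! ### Classification of singular tensors -/

section Types

variable {k : Type*} [Field k]

/-- Every subspace of a symplectic space has a basis with Gram matrix over `{0, 1, -1}`. -/
theorem exists_basis_gram_sign {l : Type*} [Fintype l] [DecidableEq l]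
    (K : Submodule k (l ⊕ l → k)) :
    ∃ (n : ℕ) (v : Fin n → l ⊕ l → k) (G : Fin n → Fin n → SignType), LinearIndependent k v ∧
      Submodule.span k (Set.range v) = K ∧ ∀ i j, sform l k (v i) (v j) = (G i j : k) := by
  induction hd : Module.finrank k K using Nat.strong_induction_on generalizing K with
  | _ d ih =>
  by_cases h0 : ∀ x ∈ K, ∀ y ∈ K, sform l k x y = 0
  · let b := Module.finBasis k K
    refine ⟨_, fun i => (b i : l ⊕ l → k), fun _ _ => 0, ?_, ?_, fun i j => ?_⟩
    · exact b.linearIndependent.map' K.subtype (Submodule.ker_subtype K)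
    · rw [Set.range_comp' Subtype.val b, ← Submodule.coe_subtype, Submodule.span_image,
        b.span_eq, Submodule.map_top, Submodule.range_subtype]
    · simpa using h0 _ (b i).2 _ (b j).2
  · push Not at h0
    obtain ⟨x, hx, y, hy, hxy⟩ := h0
    obtain ⟨y, hy, hxy⟩ : ∃ y ∈ K, sform l k x y = 1 :=
      ⟨(sform l k x y)⁻¹ • y, K.smul_mem _ hy, by rw [map_smul, smul_eq_mul, inv_mul_cancel₀ hxy]⟩
    have hyx : sform l k y x = -1 := by rw [sform_neg, hxy]
    -- Split off the hyperbolic pair `x, y`: `K` is the orthogonal sum of its span and `K'`, and the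
    -- `K'`-component of `z` is `z + B(y, z) x - B(x, z) y`.
    let K' : Submodule k (l ⊕ l → k) :=
      K ⊓ (LinearMap.ker (sform l k x) ⊓ LinearMap.ker (sform l k y))
    have hK' : ∀ z, z ∈ K' ↔ z ∈ K ∧ sform l k x z = 0 ∧ sform l k y z = 0 := fun z => Iff.rfl
    have hlt : K' < K := by
      refine lt_of_le_of_ne inf_le_left fun h => ?_
      have hxK : x ∈ K' := h ▸ hx
      have := ((hK' x).1 hxK).2.2
      rw [hyx] at this
      exact one_ne_zero (neg_eq_zero.mp this)
    obtain ⟨n, v, G, hv, hspan, hG⟩ := ih _ (hd ▸ Submodule.finrank_lt_finrank_of_lt hlt) K' rfl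
    have hvK : ∀ i, v i ∈ K' := fun i => hspan ▸ Submodule.subset_span ⟨i, rfl⟩
    have hxv : ∀ i, sform l k x (v i) = 0 := fun i => ((hK' _).1 (hvK i)).2.1
    have hyv : ∀ i, sform l k y (v i) = 0 := fun i => ((hK' _).1 (hvK i)).2.2
    refine ⟨n + 2, Fin.cons x (Fin.cons y v), Fin.cons (Fin.cons 0 (Fin.cons 1 fun _ => 0))
      (Fin.cons (Fin.cons (-1) (Fin.cons 0 fun _ => 0))
        (fun i => Fin.cons 0 (Fin.cons 0 fun j => G i j))), ?_, ?_, ?_⟩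
    · rw [linearIndependent_finCons, linearIndependent_finCons, Fin.range_cons]
      refine ⟨⟨hv, fun h => ?_⟩, fun h => ?_⟩
      · rw [hspan, hK', hxy] at h
        exact one_ne_zero h.2.1
      · have : Submodule.span k (insert y (Set.range v)) ≤ LinearMap.ker (sform l k y) := by
          rw [Submodule.span_le, Set.insert_subset_iff]
          refine ⟨sform_self y, ?_⟩
          rintro _ ⟨i, rfl⟩
          exact hyv i
        have := this h
        rw [LinearMap.mem_ker, hyx] at this
        exact one_ne_zero (neg_eq_zero.mp this)
    · rw [Fin.range_cons, Fin.range_cons]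
      refine le_antisymm ?_ fun z hz => ?_
      · rw [Submodule.span_le, Set.insert_subset_iff, Set.insert_subset_iff]
        refine ⟨hx, hy, ?_⟩
        rintro _ ⟨i, rfl⟩
        exact ((hK' _).1 (hvK i)).1
      · have hz' : z + (sform l k y z) • x - (sform l k x z) • y ∈ K' := by
          rw [hK']
          refine ⟨K.sub_mem (K.add_mem hz (K.smul_mem _ hx)) (K.smul_mem _ hy), ?_, ?_⟩
          · simp [sform_self, hxy]
          · simp [sform_self, hyx]
        rw [← hspan] at hz'
        have h1 := Submodule.span_mono (R := k) ((Set.subset_insert y (Set.range v)).trans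
          (Set.subset_insert x _)) hz'
        have hxm : x ∈ Submodule.span k (insert x (insert y (Set.range v))) :=
          Submodule.subset_span (by simp)
        have hym : y ∈ Submodule.span k (insert x (insert y (Set.range v))) :=
          Submodule.subset_span (by simp)
        have : z = (z + (sform l k y z) • x - (sform l k x z) • y) - (sform l k y z) • x +
            (sform l k x z) • y := by abel
        rw [this]
        exact Submodule.add_mem _ (Submodule.sub_mem _ h1 (Submodule.smul_mem _ _ hxm))
          (Submodule.smul_mem _ _ hym)
    · have hvx : ∀ i, sform l k (v i) x = 0 := fun i => by rw [sform_neg, hxv, neg_zero]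
      have hvy : ∀ i, sform l k (v i) y = 0 := fun i => by rw [sform_neg, hyv, neg_zero]
      intro i j
      refine Fin.cases ?_ (Fin.cases ?_ fun i => ?_) i <;>
        refine Fin.cases ?_ (Fin.cases ?_ fun j => ?_) j <;>
        simp [sform_self, hxy, hyx, hxv, hyv, hvx, hvy, hG]

variable {m : ℕ}

/-- Matrices with totally isotropic row space whose space of linear relations between the rows has
a basis with a given Gram matrix. -/
def IsIsotropicOfType (n : ℕ) (G : Fin n → Fin n → SignType)
    (M : Matrix (Idx 2) (Idx m) k) : Prop :=
  gram M = 0 ∧ ∃ v : Fin n → Idx 2 → k, LinearIndependent k v ∧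
    (∀ a, a ᵥ* M = 0 ↔ a ∈ Submodule.span k (Set.range v)) ∧
    ∀ i j, sform (Fin 2) k (v i) (v j) = (G i j : k)

/-- Witt's theorem is used on both sides: in the 4-space it aligns the relation spaces, and in
`W_{2m}` it then matches the rows. -/
theorem IsIsotropicOfType.sameOrbit {n : ℕ} {G : Fin n → Fin n → SignType}
    {M M' : Matrix (Idx 2) (Idx m) k} (h : IsIsotropicOfType n G M)
    (h' : IsIsotropicOfType n G M') : SameOrbit M M' := by
  obtain ⟨hM, v, hv, hK, hG⟩ := h
  obtain ⟨hM', v', hv', hK', hG'⟩ := h'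
  obtain ⟨g, hg, hgv⟩ := exists_symplectic_of_gram_eq v v'
    (fun a => by
      constructor
      · intro h
        have := Fintype.linearIndependent_iff.mp hv a h
        simp [this]
      · intro h
        have := Fintype.linearIndependent_iff.mp hv' a h
        simp [this])
    (fun i j => by rw [hG, hG'])
  have hu := SymplecticGroup.symplectic_det hg
  -- Relations transform contragrediently: `a` is a relation between the rows of `(g⁻¹)ᵀ M` exactly
  -- when `g⁻¹ a` is one for `M`.
  refine IsOfType.sameOrbit (K := Submodule.span k (Set.range v')) (N := 0)
    ⟨1, one_ne_zero, (g⁻¹)ᵀ, ?_, ?_, fun a => ?_⟩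
    ⟨1, one_ne_zero, 1, one_mem _, by simpa using hM', by simpa using hK'⟩
  · rw [SymplecticGroup.transpose_mem_iff, ← SymplecticGroup.coe_inv' ⟨g, hg⟩]
    exact Subtype.property _
  · rw [one_smul, gram_mul, hM]
    simp
  · have hmap : Submodule.span k (Set.range v') =
        (Submodule.span k (Set.range v)).map (Matrix.mulVecLin g) := by
      rw [Submodule.map_span, ← Set.range_comp]
      congr 2
      exact funext fun i => (hgv i).symm
    rw [← Matrix.vecMul_vecMul, Matrix.vecMul_transpose, hK, hmap, Submodule.mem_map]
    constructor
    · exact fun h => ⟨_, h, by simp [Matrix.mulVec_mulVec, Matrix.mul_nonsing_inv _ hu]⟩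
    · rintro ⟨b, hb, rfl⟩
      simpa [Matrix.mulVec_mulVec, Matrix.nonsing_inv_mul _ hu] using hb

theorem exists_isIsotropicOfType {M : Matrix (Idx 2) (Idx m) k} (hM : gram M = 0) :
    ∃ (n : Fin 5) (G : Fin n → Fin n → SignType), IsIsotropicOfType n G M := by
  obtain ⟨n, v, G, hv, hspan, hG⟩ :=
    exists_basis_gram_sign (LinearMap.ker (Matrix.vecMulLinear M))
  have hn := hv.fintype_card_le_finrank
  simp only [Fintype.card_fin, Module.finrank_fintype_fun_eq_card, Fintype.card_sum] at hn
  exact ⟨⟨n, by omega⟩, G, hM, v, hv, fun a => by rw [hspan]; rfl, hG⟩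

theorem IsTracelessAlt.smul {N : Matrix (Idx 2) (Idx 2) k} (hN : IsTracelessAlt N) (c : k) :
    IsTracelessAlt (c • N) where
  diag i := by simp [hN.diag]
  skew i j := by simp [hN.skew i j]
  contract := by simp only [Matrix.smul_apply, ← smul_add, hN.contract, smul_zero]

theorem vecMul_eq_zero_of_det_gram {M : Matrix (Idx 2) (Idx m) k} (hM : (gram M).det ≠ 0)
    {a : Idx 2 → k} (ha : a ᵥ* M = 0) : a = 0 := by
  refine Matrix.eq_zero_of_vecMul_eq_zero hM ?_
  rw [gram, ← Matrix.vecMul_vecMul, ← Matrix.vecMul_vecMul, ha]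
  simp

theorem isOfType_bot {N : Matrix (Idx 2) (Idx 2) k} {M : Matrix (Idx 2) (Idx m) k}
    (hM : (gram M).det ≠ 0) {c : k} (hc : c ≠ 0) {g : Matrix (Idx 2) (Idx 2) k}
    (hg : g ∈ symplecticGroup (Fin 2) k) (h : g * (c ^ 2 • gram M) * gᵀ = N) :
    IsOfType ⊥ N M := by
  refine ⟨c, hc, g, hg, ?_, fun a => ?_⟩
  · rw [gram_smul, gram_mul, ← h, Matrix.mul_smul, Matrix.smul_mul]
  · rw [Submodule.mem_bot]
    refine ⟨fun h0 => ?_, fun h0 => by rw [h0, Matrix.zero_vecMul]⟩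
    rw [← Matrix.vecMul_vecMul] at h0
    exact Matrix.eq_zero_of_vecMul_eq_zero (SymplecticGroup.symplectic_det hg).ne_zero
      (vecMul_eq_zero_of_det_gram hM h0)

theorem formEnd_eq_smul {N : Matrix (Idx 2) (Idx 2) k} {a : k}
    (h : formEnd N = a • LinearMap.id) : N = a • J (Fin 2) k := by
  have h1 : -(J (Fin 2) k * N) = a • 1 := by
    refine Matrix.toLin'.injective ?_
    rw [map_smul, Matrix.toLin'_one]
    exact h
  have h2 := congrArg (fun A => J (Fin 2) k * A) h1
  simpa [← Matrix.mul_assoc, J_squared] using h2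

/-- A tensor is generic if the Gram matrix of its rows is non-degenerate and not a multiple of the
symplectic form. -/
def IsGeneric (M : Matrix (Idx 2) (Idx m) k) : Prop :=
  (gram M).det ≠ 0 ∧ ∀ a : k, gram M ≠ a • J (Fin 2) k

theorem IsGeneric.isOfType [IsAlgClosed k] {v : V k m} (hv : Q v = 0)
    (h : IsGeneric (toMat v)) : IsOfType ⊥ (genForm k) (toMat v) := by
  have hN := isTracelessAlt_gram hv
  have hp := pf_ne_zero hN h.1
  -- Scaling the tensor by `c` scales the Gram matrix by `c²` and its Pfaffian by `c⁴`.
  obtain ⟨c, hc⟩ := IsAlgClosed.exists_pow_nat_eq (pf (gram (toMat v)))⁻¹ (n := 4) (by norm_num)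
  have hc0 : c ≠ 0 := by
    rintro rfl
    exact inv_ne_zero hp (by rw [← hc]; simp)
  have hp1 : pf (c ^ 2 • gram (toMat v)) = 1 := by
    rw [← inv_mul_cancel₀ hp, ← hc]
    simp only [pf, Matrix.smul_apply, smul_eq_mul]
    ring
  -- If every vector were an eigenvector, the endomorphism would be scalar and the Gram matrix a
  -- multiple of `J`.
  obtain ⟨x, hx⟩ : ∃ x, LinearIndependent k ![x, formEnd (c ^ 2 • gram (toMat v)) x] := by
    by_contra! hne
    obtain ⟨a, ha⟩ :=
      LinearMap.exists_eq_smul_id_of_forall_notLinearIndependent (fun x => hne x)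
    refine h.2 ((c ^ 2)⁻¹ * a) ?_
    rw [mul_smul, ← formEnd_eq_smul ha, inv_smul_smul₀ (pow_ne_zero 2 hc0)]
  obtain ⟨g, hg, hgN⟩ := exists_genForm (hN.smul (c ^ 2)) hp1 hx
  exact isOfType_bot h.1 hc0 hg hgN

/-- For singular tensors this case arises only in characteristic two, because the contraction of `J`
is `-2`. -/
theorem isOfType_J [IsAlgClosed k] {M : Matrix (Idx 2) (Idx m) k}
    (hM : (gram M).det ≠ 0) {a : k} (h : gram M = a • J (Fin 2) k) :
    IsOfType ⊥ (J (Fin 2) k) M := by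
  have ha : a ≠ 0 := by
    rintro rfl
    rw [zero_smul] at h
    rw [h] at hM
    exact hM (by simp)
  obtain ⟨c, hc⟩ := IsAlgClosed.exists_pow_nat_eq a⁻¹ (n := 2) (by norm_num)
  have hc0 : c ≠ 0 := by
    rintro rfl
    exact inv_ne_zero ha (by rw [← hc]; simp)
  refine isOfType_bot hM hc0 (one_mem _) ?_
  rw [hc, h, inv_smul_smul₀ ha]
  simp

/-- The possible spaces of relations between the rows for the degenerate normal form. -/
def degKer (k : Type*) [Field k] : Fin 3 → Submodule k (Idx 2 → k) :=
  ![⊥, Submodule.span k {Pi.single (Sum.inl 1) 1},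
    Submodule.span k {Pi.single (Sum.inl 1) 1, Pi.single (Sum.inr 0) 1}]

theorem vecMul_degForm {a : Idx 2 → k} (h : a ᵥ* degForm k = 0) :
    a = a (Sum.inl 1) • Pi.single (Sum.inl 1) 1 + a (Sum.inr 0) • Pi.single (Sum.inr 0) 1 := by
  have h1 := congrFun h (Sum.inl 0)
  have h2 := congrFun h (Sum.inr 1)
  simp only [degForm, Matrix.vecMul, dotProduct, Fintype.sum_sum_type, Fin.sum_univ_two,
    fromBlocks_apply₁₁, fromBlocks_apply₂₁, fromBlocks_apply₁₂, fromBlocks_apply₂₂] at h1 h2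
  simp at h1 h2
  funext i
  rcases i with i | i <;> fin_cases i <;> simp [h1, h2]

/-- A relation between the rows lies in the radical of the Gram matrix, which is the image of `T`.
If there is a non-zero relation, write it as `T x'` and rebuild the normal basis from `x'`. The
basis vector `e_2` is then a relation, and the relation space is either spanned by it or is the
whole radical. -/
theorem exists_isOfType_degForm {v : V k m} (hv : Q v = 0) (hd : (gram (toMat v)).det = 0)
    (h0 : gram (toMat v) ≠ 0) : ∃ i, IsOfType (degKer k i) (degForm k) (toMat v) := by
  have hN := isTracelessAlt_gram hv
  have hp := pf_eq_zero hN hd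
  set M := toMat v with hMdef
  set N := gram M with hNdef
  obtain ⟨x, hx⟩ : ∃ x, formEnd N x ≠ 0 := by
    by_contra! hne
    refine h0 ?_
    rw [formEnd_eq_smul (N := N) (a := 0) (by rw [zero_smul]; exact LinearMap.ext hne), zero_smul]
  have hker : ∀ g : Matrix (Idx 2) (Idx 2) k, g * N * gᵀ = degForm k → ∀ a, a ᵥ* (g * M) = 0 →
      a = a (Sum.inl 1) • Pi.single (Sum.inl 1) 1 + a (Sum.inr 0) • Pi.single (Sum.inr 0) 1 := by
    intro g hg a ha
    refine vecMul_degForm ?_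
    rw [← hg, ← gram_mul, gram, ← Matrix.vecMul_vecMul, ← Matrix.vecMul_vecMul, ha]
    simp
  obtain ⟨g, hg, hgN, g1, g2, g3⟩ := exists_degForm hN hp hx
  by_cases hK : ∀ a, a ᵥ* (g * M) = 0 → a = 0
  · exact ⟨0, 1, one_ne_zero, g, hg, by rw [one_smul, gram_mul, hgN], fun a =>
      ⟨fun h => by simpa [degKer] using hK a h, fun h => by
        have : a = 0 := by simpa [degKer] using h
        rw [this, Matrix.zero_vecMul]⟩⟩
  · push Not at hK
    obtain ⟨a, ha, ha0⟩ := hK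
    have hag : a ᵥ* g = formEnd N (a (Sum.inl 1) • x + a (Sum.inr 0) • g (Sum.inr 1)) := by
      rw [map_add, map_smul, map_smul, ← g3, ← g2]
      conv_lhs => rw [hker g hgN a ha]
      rw [Matrix.add_vecMul, Matrix.smul_vecMul, Matrix.smul_vecMul, Matrix.single_one_vecMul,
        Matrix.single_one_vecMul]
      rfl
    set x' := a (Sum.inl 1) • x + a (Sum.inr 0) • g (Sum.inr 1)
    have hx' : formEnd N x' ≠ 0 := by
      rw [← hag]
      exact fun h => ha0 (Matrix.eq_zero_of_vecMul_eq_zero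
        (SymplecticGroup.symplectic_det hg).ne_zero h)
    have hx'M : formEnd N x' ᵥ* M = 0 := by rw [← hag, Matrix.vecMul_vecMul, ha]
    obtain ⟨g', hg', hgN', g1', g2', g3'⟩ := exists_degForm hN hp hx'
    have hsingle : ∀ j, (Pi.single j 1 : Idx 2 → k) ᵥ* (g' * M) = g' j ᵥ* M := fun j => by
      rw [← Matrix.vecMul_vecMul, Matrix.single_one_vecMul]
      rfl
    have e1 : (Pi.single (Sum.inl 1) 1 : Idx 2 → k) ᵥ* (g' * M) = 0 := by
      rw [hsingle, g2', hx'M]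
    by_cases e2 : (Pi.single (Sum.inr 0) 1 : Idx 2 → k) ᵥ* (g' * M) = 0
    · refine ⟨2, 1, one_ne_zero, g', hg', by rw [one_smul, gram_mul, hgN'], fun b => ?_⟩
      change _ ↔ b ∈ Submodule.span k {Pi.single (Sum.inl 1) 1, Pi.single (Sum.inr 0) 1}
      rw [Submodule.mem_span_pair]
      constructor
      · exact fun hb => ⟨_, _, (hker g' hgN' b hb).symm⟩
      · rintro ⟨s, t, rfl⟩
        rw [Matrix.add_vecMul, Matrix.smul_vecMul, Matrix.smul_vecMul, e1, e2]
        simp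
    · refine ⟨1, 1, one_ne_zero, g', hg', by rw [one_smul, gram_mul, hgN'], fun b => ?_⟩
      change _ ↔ b ∈ Submodule.span k {Pi.single (Sum.inl 1) 1}
      rw [Submodule.mem_span_singleton]
      constructor
      · intro hb
        have hb' := hker g' hgN' b hb
        refine ⟨b (Sum.inl 1), ?_⟩
        have h3 := hb
        rw [hb', Matrix.add_vecMul, Matrix.smul_vecMul, Matrix.smul_vecMul, e1, smul_zero,
          zero_add, smul_eq_zero] at h3
        rw [h3.resolve_right e2, zero_smul, add_zero] at hb'
        exact hb'.symm
      · rintro ⟨s, rfl⟩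
        rw [Matrix.smul_vecMul, e1, smul_zero]

end Types

/-! ### Finiteness of the set of orbits -/

section Finiteness

variable {k : Type*} [Field k] {m : ℕ}

theorem mem_singularPoints_mk {v : V k m} (hv : v ≠ 0) :
    Projectivization.mk k v hv ∈ singularPoints k m ↔ Q v = 0 := by
  constructor
  · intro h
    exact h v (by rw [Projectivization.submodule_mk]; exact Submodule.mem_span_singleton_self v)
  · intro h w hw
    rw [Projectivization.submodule_mk, Submodule.mem_span_singleton] at hw
    obtain ⟨c, rfl⟩ := hw
    have : Q (c • v) = c ^ 2 * Q v := by
      simp only [Q, Finset.mul_sum, Pi.smul_apply, smul_eq_mul]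
      exact Finset.sum_congr rfl fun i _ => Finset.sum_congr rfl fun j _ => by ring
    rw [this, h, mul_zero]

/-- `Sp_4 ⊗ Sp_{2m}` has finitely many orbits on singular points. -/
theorem finite_orbits (k : Type*) [Field k] [IsAlgClosed k] (m : ℕ) :
    {O : Set (ℙ k (V k m)) | ∃ x ∈ singularPoints k m, O = orbit x}.Finite := by
  -- The index type of the classes is finite: a relation space has dimension at most 4, and its Gram
  -- matrix has entries in `{0, 1, -1}`. Each class meets at most one orbit.
  let P : Option (Option (Fin 3 ⊕ Σ n : Fin 5, (Fin n → Fin n → SignType))) →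
      Matrix (Idx 2) (Idx m) k → Prop := fun i M =>
    match i with
    | none => IsOfType ⊥ (genForm k) M
    | some none => IsOfType ⊥ (J (Fin 2) k) M
    | some (some (Sum.inl i)) => IsOfType (degKer k i) (degForm k) M
    | some (some (Sum.inr p)) => IsIsotropicOfType p.1 p.2 M
  have hP : ∀ i M M', P i M → P i M' → SameOrbit M M' := by
    rintro (_ | _ | i | p) M M' h h'
    · exact IsOfType.sameOrbit h h'
    · exact IsOfType.sameOrbit h h'
    · exact IsOfType.sameOrbit h h'
    · exact IsIsotropicOfType.sameOrbit h h'
  have hcover : ∀ v : V k m, Q v = 0 → ∃ i, P i (toMat v) := by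
    intro v hv
    by_cases hd : (gram (toMat v)).det = 0
    · by_cases h0 : gram (toMat v) = 0
      · obtain ⟨n, G, h⟩ := exists_isIsotropicOfType h0
        exact ⟨some (some (Sum.inr ⟨n, G⟩)), h⟩
      · obtain ⟨i, hi⟩ := exists_isOfType_degForm hv hd h0
        exact ⟨some (some (Sum.inl i)), hi⟩
    · by_cases hJ : ∃ a : k, gram (toMat v) = a • J (Fin 2) k
      · obtain ⟨a, ha⟩ := hJ
        exact ⟨some none, isOfType_J hd ha⟩
      · push Not at hJ
        exact ⟨none, IsGeneric.isOfType hv ⟨hd, hJ⟩⟩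
  refine (Set.finite_iUnion (f := fun i => {O : Set (ℙ k (V k m)) | ∃ (v : V k m) (hv : v ≠ 0),
    P i (toMat v) ∧ O = orbit (Projectivization.mk k v hv)}) fun i => ?_).subset ?_
  · refine Set.Subsingleton.finite ?_
    rintro _ ⟨v, hv, h, rfl⟩ _ ⟨w, hw, h', rfl⟩
    exact orbit_eq_of_sameOrbit hv hw (hP i _ _ h h')
  · rintro _ ⟨x, hx, rfl⟩
    induction x using Projectivization.ind with
    | h v hv =>
      obtain ⟨i, hi⟩ := hcover v ((mem_singularPoints_mk hv).mp hx)
      exact Set.mem_iUnion.mpr ⟨i, v, hv, hi, rfl⟩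

end Finiteness

/-! ### The decomposition of `W_{2m}` as `W_4 ⊥ W_{2r}` -/

section Embedding

variable {k : Type*} {r m : ℕ}

/-- The decomposition `W_{2m} = W_4 ⊥ W_{2r}`, on indices of the standard bases. -/
def idxEquiv (e : Fin 2 ⊕ Fin r ≃ Fin m) : Idx 2 ⊕ Idx r ≃ Idx m :=
  (Equiv.sumSumSumComm _ _ _ _).trans (Equiv.sumCongr e e)

/-- The endomorphism of `W_4 ⊥ W_{2r}` with given components. -/
def blockSum [Zero k] (e : Fin 2 ⊕ Fin r ≃ Fin m) (A : Matrix (Idx 2) (Idx 2) k)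
    (D : Matrix (Idx r) (Idx r) k) : Matrix (Idx m) (Idx m) k :=
  (fromBlocks A 0 0 D).submatrix (idxEquiv e).symm (idxEquiv e).symm

/-- A tensor in `W_4 ⊗ W_4`, as a tensor in `W_4 ⊗ (W_4 ⊥ W_{2r})`. -/
def pad [Zero k] (e : Fin 2 ⊕ Fin r ≃ Fin m) (M : Matrix (Idx 2) (Idx 2) k) :
    Matrix (Idx 2) (Idx m) k :=
  (fromCols M 0).submatrix id (idxEquiv e).symm

variable [CommRing k] (e : Fin 2 ⊕ Fin r ≃ Fin m)

theorem J_eq_blockSum : J (Fin m) k = blockSum e (J (Fin 2) k) (J (Fin r) k) := by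
  rw [blockSum, ← Matrix.reindex_apply, ← Equiv.symm_apply_eq]
  ext i j
  rcases i with (i | i) | (i | i) <;> rcases j with (j | j) | (j | j) <;>
    simp [idxEquiv, J, Matrix.one_apply]

theorem blockSum_mul (A B : Matrix (Idx 2) (Idx 2) k) (C D : Matrix (Idx r) (Idx r) k) :
    blockSum e A C * blockSum e B D = blockSum e (A * B) (C * D) := by
  simp [blockSum, Matrix.submatrix_mul_equiv, fromBlocks_multiply]

theorem blockSum_transpose (A : Matrix (Idx 2) (Idx 2) k) (D : Matrix (Idx r) (Idx r) k) :
    (blockSum e A D)ᵀ = blockSum e Aᵀ Dᵀ := by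
  simp [blockSum, Matrix.transpose_submatrix, fromBlocks_transpose]

theorem blockSum_smul_one (c : k) :
    blockSum e (c • (1 : Matrix (Idx 2) (Idx 2) k)) (c • 1) = c • 1 := by
  have : fromBlocks (c • (1 : Matrix (Idx 2) (Idx 2) k)) 0 0 (c • (1 : Matrix (Idx r) (Idx r) k)) =
      c • 1 := by
    ext i j
    rcases i with i | i <;> rcases j with j | j <;> simp [Matrix.one_apply]
  rw [blockSum, this]
  ext i j
  simp [Matrix.one_apply]

theorem blockSum_one : blockSum e (1 : Matrix (Idx 2) (Idx 2) k) 1 = 1 := by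
  simpa using blockSum_smul_one e (1 : k)

theorem blockSum_injective {A B : Matrix (Idx 2) (Idx 2) k} {C D : Matrix (Idx r) (Idx r) k} :
    blockSum e A C = blockSum e B D ↔ A = B ∧ C = D := by
  constructor
  · intro h
    have h' := congrArg (fun M => M.submatrix (idxEquiv e) (idxEquiv e)) h
    simp only [blockSum, Matrix.submatrix_submatrix, Equiv.symm_comp_self,
      Matrix.submatrix_id_id] at h'
    rw [fromBlocks_inj] at h'
    exact ⟨h'.1, h'.2.2.2⟩
  · rintro ⟨rfl, rfl⟩
    rfl

theorem blockSum_mem_iff {A : Matrix (Idx 2) (Idx 2) k} {D : Matrix (Idx r) (Idx r) k} :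
    blockSum e A D ∈ symplecticGroup (Fin m) k ↔
      A ∈ symplecticGroup (Fin 2) k ∧ D ∈ symplecticGroup (Fin r) k := by
  rw [SymplecticGroup.mem_iff, SymplecticGroup.mem_iff, SymplecticGroup.mem_iff, J_eq_blockSum e,
    blockSum_transpose, blockSum_mul, blockSum_mul, blockSum_injective]

theorem mul_pad (g M : Matrix (Idx 2) (Idx 2) k) : g * pad e M = pad e (g * M) := by
  rw [pad, pad]
  have := Matrix.submatrix_mul_equiv g (fromCols M (0 : Matrix (Idx 2) (Idx r) k)) id
    (Equiv.refl _) (idxEquiv e).symm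
  simp only [Equiv.coe_refl, Matrix.submatrix_id_id] at this
  rw [this, Matrix.mul_fromCols, Matrix.mul_zero]

theorem pad_mul_blockSum (M A : Matrix (Idx 2) (Idx 2) k) (D : Matrix (Idx r) (Idx r) k) :
    pad e M * blockSum e A D = pad e (M * A) := by
  rw [pad, blockSum, Matrix.submatrix_mul_equiv, Matrix.fromCols_mul_fromBlocks, pad]
  simp

theorem pad_mul_pad_transpose (M M' : Matrix (Idx 2) (Idx 2) k) :
    pad e M * (pad e M')ᵀ = M * M'ᵀ := by
  rw [pad, pad, Matrix.transpose_submatrix, Matrix.submatrix_mul_equiv, Matrix.transpose_fromCols,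
    Matrix.fromCols_mul_fromRows]
  simp

theorem gram_pad (M : Matrix (Idx 2) (Idx 2) k) :
    gram (pad e M) = M * J (Fin 2) k * Mᵀ := by
  rw [gram, J_eq_blockSum e, pad_mul_blockSum, pad_mul_pad_transpose]

theorem pad_smul (c : k) (M : Matrix (Idx 2) (Idx 2) k) : pad e (c • M) = c • pad e M := by
  ext i j
  obtain ⟨j, rfl⟩ := (idxEquiv e).surjective j
  rcases j with j | j <;> simp [pad]

/-- A symplectic map that preserves the non-degenerate subspace `W_4` preserves its complement. -/
theorem exists_blockSum_of_stabilizes {g M : Matrix (Idx 2) (Idx 2) k} (hg : IsUnit g.det)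
    (hM : IsUnit M.det) {h : Matrix (Idx m) (Idx m) k} (hh : h ∈ symplecticGroup (Fin m) k)
    {c : k} (H : g * pad e M * hᵀ = c • pad e M) :
    ∃ A ∈ symplecticGroup (Fin 2) k, ∃ D ∈ symplecticGroup (Fin r) k, h = blockSum e A D ∧
      g * M * Aᵀ = c • M := by
  obtain ⟨A, B, C, D, rfl⟩ : ∃ A B C D, h = (fromBlocks A B C D).submatrix (idxEquiv e).symm
      (idxEquiv e).symm := by
    let h' := h.submatrix (idxEquiv e) (idxEquiv e)
    refine ⟨h'.toBlocks₁₁, h'.toBlocks₁₂, h'.toBlocks₂₁, h'.toBlocks₂₂, ?_⟩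
    rw [fromBlocks_toBlocks]
    simp [h', Matrix.submatrix_submatrix]
  rw [mul_pad, ← pad_smul, pad, pad, Matrix.transpose_submatrix, Matrix.submatrix_mul_equiv] at H
  have H' := congrArg (fun M => M.submatrix id (idxEquiv e)) H
  simp only [Matrix.submatrix_submatrix, Equiv.symm_comp_self, Function.comp_id,
    Matrix.submatrix_id_id] at H'
  rw [fromBlocks_transpose, Matrix.fromCols_mul_fromBlocks] at H'
  have H1 := (Matrix.fromCols_inj H').1
  have H2 := (Matrix.fromCols_inj H').2
  rw [Matrix.zero_mul, add_zero] at H1 H2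
  -- The rows of `pad e M` span the summand `W_4`, so preserving the tensor up to a scalar forces
  -- `h` to map `W_4` into itself.
  have hC : C = 0 := by
    have hu : IsUnit (g * M).det := by rw [Matrix.det_mul]; exact hg.mul hM
    have := congrArg (fun Z => ((g * M)⁻¹ * Z)ᵀ) H2
    simpa [Matrix.nonsing_inv_mul_cancel_left _ _ hu] using this
  subst hC
  have hh' := hh
  rw [SymplecticGroup.mem_iff, J_eq_blockSum e, blockSum, Matrix.transpose_submatrix,
    Matrix.submatrix_mul_equiv, Matrix.submatrix_mul_equiv] at hh'
  have hh'' := congrArg (fun M => M.submatrix (idxEquiv e) (idxEquiv e)) hh'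
  simp only [Matrix.submatrix_submatrix, Equiv.symm_comp_self, Matrix.submatrix_id_id,
    fromBlocks_transpose, fromBlocks_multiply, fromBlocks_inj] at hh''
  obtain ⟨-, h12, -, h22⟩ := hh''
  simp only [Matrix.mul_zero, Matrix.zero_mul, zero_add, add_zero, Matrix.transpose_zero]
    at h12 h22
  have hD : D ∈ symplecticGroup (Fin r) k := SymplecticGroup.mem_iff.mpr h22
  -- The off-diagonal block of the symplectic condition reads `B J Dᵀ = 0`, and `D` is symplectic,
  -- hence invertible.
  have hB : B = 0 := by
    have hDu : IsUnit (J (Fin r) k * Dᵀ).det := by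
      rw [Matrix.det_mul, Matrix.det_transpose]
      exact (isUnit_det_J _ _).mul (SymplecticGroup.symplectic_det hD)
    rw [Matrix.mul_assoc] at h12
    have := congrArg (fun Z => Z * (J (Fin r) k * Dᵀ)⁻¹) h12
    simpa [Matrix.mul_nonsing_inv_cancel_right _ _ hDu] using this
  subst hB
  exact ⟨A, ((blockSum_mem_iff e).mp hh).1, D, hD, rfl, H1⟩

end Embedding

/-! ### Evaluation of homogeneous polynomials -/

section Polynomials

variable {σ k : Type*} [CommRing k]

theorem eval_smul_of_isHomogeneous {F : MvPolynomial σ k} {d : ℕ} (hF : F.IsHomogeneous d) (c : k)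
    (v : σ → k) : MvPolynomial.eval (c • v) F = c ^ d * MvPolynomial.eval v F := by
  rw [MvPolynomial.eval_eq, MvPolynomial.eval_eq, Finset.mul_sum]
  refine Finset.sum_congr rfl fun s hs => ?_
  simp only [Pi.smul_apply, smul_eq_mul, mul_pow, Finset.prod_mul_distrib,
    Finset.prod_pow_eq_pow_sum, ← hF.degree_eq_sum_deg_support hs]
  ring

theorem eval_aeval_polynomial (F : MvPolynomial σ k) (c : σ → Polynomial k) (t : k) :
    (MvPolynomial.aeval c F).eval t = MvPolynomial.eval (fun i => (c i).eval t) F := by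
  induction F using MvPolynomial.induction_on with
  | C a => simp
  | add p q hp hq => simp [hp, hq]
  | mul_X p i hp => simp [hp]

theorem eval_rep_eq_zero_iff {σ k : Type*} [Field k] {F : MvPolynomial σ k} {d : ℕ}
    (hF : F.IsHomogeneous d) {v : σ → k} (hv : v ≠ 0) :
    MvPolynomial.eval (Projectivization.mk k v hv).rep F = 0 ↔ MvPolynomial.eval v F = 0 := by
  obtain ⟨a, ha⟩ := Projectivization.exists_smul_eq_mk_rep k v hv
  rw [← ha, Units.smul_def, eval_smul_of_isHomogeneous hF, mul_eq_zero, or_iff_right]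
  exact pow_ne_zero _ a.ne_zero

theorem isHomogeneous_det {n : Type*} [Fintype n] [DecidableEq n]
    {A : Matrix n n (MvPolynomial σ k)} {d : ℕ} (hA : ∀ i j, (A i j).IsHomogeneous d) :
    A.det.IsHomogeneous (Fintype.card n * d) := by
  rw [Matrix.det_apply]
  refine MvPolynomial.IsHomogeneous.sum _ _ _ fun s _ => ?_
  have h : (∏ i, A (s i) i).IsHomogeneous (Fintype.card n * d) := by
    have := MvPolynomial.IsHomogeneous.prod Finset.univ (fun i => A (s i) i) (fun _ => d)
      fun i _ => hA _ _
    simpa using this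
  rcases Int.units_eq_one_or (Equiv.Perm.sign s) with h1 | h1 <;> rw [h1]
  · simpa using h
  · simpa using h.neg

end Polynomials

/-! ### Irreducibility of the quadric and the dense orbit -/

section Quadric

variable {k : Type*} [Field k] {m : ℕ}

/-- The pure tensor, as a bilinear map. -/
def tmulLin (k : Type*) [Field k] (m : ℕ) : (Idx 2 → k) →ₗ[k] (Idx m → k) →ₗ[k] V k m :=
  LinearMap.mk₂ k tmul (fun a b c => by ext; simp [tmul, add_mul])
    (fun c a b => by ext; simp [tmul, mul_assoc]) (fun a b c => by ext; simp [tmul, mul_add])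
    (fun c a b => by ext; simp [tmul, mul_left_comm])

/-- The polar form of `Q`. -/
def polar (v : V k m) : V k m →ₗ[k] k where
  toFun w := ∑ i : Fin 2, ∑ j : Fin m,
    (v (Sum.inl i, Sum.inl j) * w (Sum.inr i, Sum.inr j) +
      v (Sum.inr i, Sum.inr j) * w (Sum.inl i, Sum.inl j) -
      v (Sum.inl i, Sum.inr j) * w (Sum.inr i, Sum.inl j) -
      v (Sum.inr i, Sum.inl j) * w (Sum.inl i, Sum.inr j))
  map_add' w w' := by
    simp only [← Finset.sum_add_distrib, Pi.add_apply]
    exact Finset.sum_congr rfl fun i _ => Finset.sum_congr rfl fun j _ => by ring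
  map_smul' c w := by
    simp only [Finset.mul_sum, Pi.smul_apply, smul_eq_mul, RingHom.id_apply]
    exact Finset.sum_congr rfl fun i _ => Finset.sum_congr rfl fun j _ => by ring

theorem polar_apply (v w : V k m) : polar v w = ∑ i : Fin 2, ∑ j : Fin m,
    (v (Sum.inl i, Sum.inl j) * w (Sum.inr i, Sum.inr j) +
      v (Sum.inr i, Sum.inr j) * w (Sum.inl i, Sum.inl j) -
      v (Sum.inl i, Sum.inr j) * w (Sum.inr i, Sum.inl j) -
      v (Sum.inr i, Sum.inl j) * w (Sum.inl i, Sum.inr j)) := rfl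

theorem polar_comm (v w : V k m) : polar v w = polar w v := by
  rw [polar_apply, polar_apply]
  exact Finset.sum_congr rfl fun i _ => Finset.sum_congr rfl fun j _ => by ring

theorem Q_smul_add_smul (a b : k) (v w : V k m) :
    Q (a • v + b • w) = a ^ 2 * Q v + b ^ 2 * Q w + a * b * polar v w := by
  simp only [Q, polar_apply, Finset.mul_sum, ← Finset.sum_add_distrib, Pi.add_apply, Pi.smul_apply,
    smul_eq_mul]
  exact Finset.sum_congr rfl fun i _ => Finset.sum_congr rfl fun j _ => by ring

theorem exists_polar_tmul_ne_zero {v : V k m} (hv : v ≠ 0) :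
    ∃ a b, polar v (tmul a b) ≠ 0 := by
  by_contra! h
  refine hv (funext fun p => ?_)
  obtain ⟨i, j⟩ := p
  rcases i with i | i <;> rcases j with j | j
  · simpa [polar_apply, tmul, Pi.single_apply] using
      h (Pi.single (Sum.inr i) 1) (Pi.single (Sum.inr j) 1)
  · simpa [polar_apply, tmul, Pi.single_apply] using
      h (Pi.single (Sum.inr i) 1) (Pi.single (Sum.inl j) 1)
  · simpa [polar_apply, tmul, Pi.single_apply] using
      h (Pi.single (Sum.inl i) 1) (Pi.single (Sum.inr j) 1)
  · simpa [polar_apply, tmul, Pi.single_apply] using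
      h (Pi.single (Sum.inl i) 1) (Pi.single (Sum.inl j) 1)

/-- Two vectors have a common singular vector that is orthogonal to neither. -/
theorem exists_singular_polar_ne_zero {v w : V k m} (hv : v ≠ 0) (hw : w ≠ 0) :
    ∃ u, Q u = 0 ∧ polar v u ≠ 0 ∧ polar w u ≠ 0 := by
  obtain ⟨a, b, h⟩ := exists_polar_tmul_ne_zero hv
  obtain ⟨a', b', h'⟩ := exists_polar_tmul_ne_zero hw
  -- A pure tensor `x ⊗ y` is singular for free. Its factors are adjusted one at a time, first `y`
  -- and then `x`.
  obtain ⟨y, -, hy, hy'⟩ := exists_both_ne_zero ((polar v).comp (tmulLin k m a))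
    ((polar w).comp (tmulLin k m a')) (a := b) (b := b') h h'
  obtain ⟨x, -, hx, hx'⟩ := exists_both_ne_zero ((polar v).comp ((tmulLin k m).flip y))
    ((polar w).comp ((tmulLin k m).flip y)) (a := a) (b := a') hy hy'
  exact ⟨tmul x y, Q_tmul x y, hx, hx'⟩

/-- The quadric `Q = 0` is irreducible: if the product of two forms vanishes on it, then so does one
of them. -/
theorem eval_eq_zero_of_mul [Infinite k] {F G : MvPolynomial (Idx 2 × Idx m) k} {d d' : ℕ}
    (hF : F.IsHomogeneous d) (hG : G.IsHomogeneous d')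
    (h : ∀ v : V k m, Q v = 0 → MvPolynomial.eval v F * MvPolynomial.eval v G = 0)
    {w : V k m} (hw : Q w = 0) (hw0 : w ≠ 0) (hGw : MvPolynomial.eval w G ≠ 0)
    {v : V k m} (hv : Q v = 0) (hv0 : v ≠ 0) : MvPolynomial.eval v F = 0 := by
  obtain ⟨u, hu, huv, huw⟩ := exists_singular_polar_ne_zero hv0 hw0
  -- A polynomial curve on the quadric from a multiple of `v` to a multiple of `w`. For `p = (1 - t)
  -- v + t w` one has `Q p = t (1 - t) polar v w`, and the line through `u` and `p` meets the
  -- quadric again in `polar p u • p - Q p • u`.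
  let c : Idx 2 × Idx m → Polynomial k := fun i =>
    ((1 - Polynomial.X) * Polynomial.C (polar v u) + Polynomial.X * Polynomial.C (polar w u)) *
      ((1 - Polynomial.X) * Polynomial.C (v i) + Polynomial.X * Polynomial.C (w i)) -
      (1 - Polynomial.X) * Polynomial.X * Polynomial.C (polar v w * u i)
  have hc : ∀ t, (fun i => (c i).eval t) = ((1 - t) * polar v u + t * polar w u) •
      ((1 - t) • v + t • w) + (-((1 - t) * t * polar v w)) • u := fun t => by
    funext i
    simp [c]
    ring
  have hQc : ∀ t, Q (fun i => (c i).eval t) = 0 := fun t => by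
    rw [hc, Q_smul_add_smul, Q_smul_add_smul, hv, hw, hu, polar_comm (_ + _) u, map_add,
      map_smul, map_smul, polar_comm u v, polar_comm u w]
    simp only [smul_eq_mul]
    ring
  -- Along the curve, `F` and `G` become polynomials in one variable with product zero, so one of
  -- them vanishes identically. It is not `G`, because of `w`.
  have hprod : MvPolynomial.aeval c F * MvPolynomial.aeval c G = 0 := by
    refine Polynomial.funext fun t => ?_
    rw [Polynomial.eval_mul, eval_aeval_polynomial, eval_aeval_polynomial, h _ (hQc t),
      Polynomial.eval_zero]
  rcases mul_eq_zero.mp hprod with h0 | h0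
  · have h1 := congrArg (Polynomial.eval 0) h0
    rw [eval_aeval_polynomial, hc, Polynomial.eval_zero] at h1
    simp only [sub_zero, one_mul, zero_mul, add_zero, one_smul, zero_smul, mul_zero, neg_zero] at h1
    rw [eval_smul_of_isHomogeneous hF] at h1
    exact (mul_eq_zero.mp h1).resolve_left (pow_ne_zero _ huv)
  · have h1 := congrArg (Polynomial.eval 1) h0
    rw [eval_aeval_polynomial, hc, Polynomial.eval_zero] at h1
    simp only [sub_self, one_mul, zero_mul, zero_add, one_smul, zero_smul, neg_zero,
      add_zero] at h1
    rw [eval_smul_of_isHomogeneous hG] at h1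
    exact absurd ((mul_eq_zero.mp h1).resolve_left (pow_ne_zero _ huw)) hGw

/-- The Gram matrix of the generic tensor. -/
noncomputable def gramPoly (k : Type*) [Field k] (m : ℕ) :
    Matrix (Idx 2) (Idx 2) (MvPolynomial (Idx 2 × Idx m) k) :=
  gram (toMat (fun p => MvPolynomial.X p))

theorem map_gramPoly (v : V k m) :
    (gramPoly k m).map (MvPolynomial.eval v) = gram (toMat v) := by
  rw [gramPoly, gram, gram, Matrix.map_mul, Matrix.map_mul, Matrix.map_J, Matrix.transpose_map]
  have : (toMat (fun p : Idx 2 × Idx m => (MvPolynomial.X p : MvPolynomial _ k))).map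
      (MvPolynomial.eval v) = toMat v := by
    ext i j
    simp [toMat]
  rw [this]

theorem eval_gramPoly (v : V k m) (i j : Idx 2) :
    MvPolynomial.eval v (gramPoly k m i j) = gram (toMat v) i j := by
  rw [← map_gramPoly v]
  rfl

theorem eval_det_gramPoly (v : V k m) :
    MvPolynomial.eval v (gramPoly k m).det = (gram (toMat v)).det := by
  rw [RingHom.map_det, ← map_gramPoly v]
  rfl

theorem isHomogeneous_gramPoly (i j : Idx 2) : (gramPoly k m i j).IsHomogeneous 2 := by
  have : gramPoly k m i j = ∑ l : Fin m,
      (MvPolynomial.X (i, Sum.inr l) * MvPolynomial.X (j, Sum.inl l) -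
        MvPolynomial.X (i, Sum.inl l) * MvPolynomial.X (j, Sum.inr l)) := by
    rw [← sform_eq_sum (fun q => MvPolynomial.X (i, q)) (fun q => MvPolynomial.X (j, q)),
      sform_apply, gramPoly, gram, Matrix.mul_assoc, Matrix.mul_apply_eq_vecMul, Matrix.vecMul]
    rfl
  rw [this]
  exact MvPolynomial.IsHomogeneous.sum _ _ _ fun l _ =>
    ((MvPolynomial.isHomogeneous_X _ _).mul (MvPolynomial.isHomogeneous_X _ _)).sub
      ((MvPolynomial.isHomogeneous_X _ _).mul (MvPolynomial.isHomogeneous_X _ _))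

/-- The corresponding entry of `J` is zero. This gives a sufficient condition for genericity in
terms of two polynomials not vanishing. -/
theorem isGeneric_of_apply_ne_zero {M : Matrix (Idx 2) (Idx m) k} (hd : (gram M).det ≠ 0)
    (h : gram M (Sum.inl 0) (Sum.inr 1) ≠ 0) : IsGeneric M :=
  ⟨hd, fun a ha => h (by rw [ha]; simp [J])⟩

theorem gram_sameOrbit {M M' : Matrix (Idx 2) (Idx m) k} (h : SameOrbit M M') :
    ∃ c : k, ∃ g ∈ symplecticGroup (Fin 2) k, gram M' = c • (g * gram M * gᵀ) := by
  obtain ⟨c, -, g, hg, h, hh, rfl⟩ := h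
  exact ⟨c ^ 2, g, hg, by rw [gram_smul, gram_mul_symplectic _ hh, gram_mul]⟩

/-- A representative of the dense orbit. -/
def genMat (k : Type*) [Field k] : Matrix (Idx 2) (Idx 2) k :=
  fromBlocks 1 0 0 !![0, 1; 1, 0]

theorem gram_pad_genMat {r : ℕ} (e : Fin 2 ⊕ Fin r ≃ Fin m) :
    gram (pad e (genMat k)) = genForm k := by
  rw [gram_pad, genMat, genForm, J, fromBlocks_transpose, fromBlocks_multiply, fromBlocks_multiply]
  congr 1 <;> simp [← Matrix.ext_iff, Fin.forall_fin_two]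

theorem det_genForm_ne_zero : (genForm k).det ≠ 0 := by
  have h : genForm k * genForm k = -1 := by
    rw [genForm, fromBlocks_multiply, ← fromBlocks_one, fromBlocks_neg]
    congr 1 <;> simp [← Matrix.ext_iff, Fin.forall_fin_two]
  intro h0
  have h1 := congrArg Matrix.det h
  rw [Matrix.det_mul, h0, mul_zero] at h1
  exact ((isUnit_one.neg : IsUnit (-1 : Matrix (Idx 2) (Idx 2) k)).map Matrix.detMonoidHom).ne_zero
    h1.symm

theorem exists_generic {r : ℕ} (e : Fin 2 ⊕ Fin r ≃ Fin m) : ∃ v : V k m, v ≠ 0 ∧ Q v = 0 ∧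
    (gram (toMat v)).det ≠ 0 ∧ gram (toMat v) (Sum.inl 0) (Sum.inr 1) ≠ 0 := by
  have h2 : gram (pad e (genMat k)) (Sum.inl 0) (Sum.inr 1) ≠ 0 := by
    rw [gram_pad_genMat]
    simp [genForm]
  refine ⟨ofMat (pad e (genMat k)), ofMat_ne_zero ?_, ?_, ?_, h2⟩
  · intro h
    rw [h] at h2
    simp [gram] at h2
  · rw [Q_eq_gram, toMat_ofMat, gram_pad_genMat]
    simp [genForm]
  · rw [toMat_ofMat, gram_pad_genMat]
    exact det_genForm_ne_zero

theorem IsGeneric.sameOrbit [IsAlgClosed k] {v w : V k m} (hv : Q v = 0) (hw : Q w = 0)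
    (h : IsGeneric (toMat v)) (h' : IsGeneric (toMat w)) : SameOrbit (toMat v) (toMat w) :=
  (h.isOfType hv).sameOrbit (h'.isOfType hw)

/-- Generic singular tensors form a single orbit. If `F` vanishes on it, then `F` times the Gram
determinant times one Gram entry vanishes on the whole quadric. By irreducibility `F` does too,
since the other factors are non-zero at an explicit singular tensor. -/
theorem IsGeneric.hasDenseOrbit [IsAlgClosed k] {r : ℕ} (e : Fin 2 ⊕ Fin r ≃ Fin m) {v : V k m}
    (hv0 : v ≠ 0) (hv : Q v = 0) (h : IsGeneric (toMat v)) :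
    HasDenseOrbit (Projectivization.mk k v hv0) := by
  intro d F hF hFO y hy
  induction y using Projectivization.ind with
  | h y hy0 =>
  rw [eval_rep_eq_zero_iff hF]
  obtain ⟨w, hw0, hw, hw1, hw2⟩ := exists_generic (k := k) e
  have : Infinite k := IsAlgClosed.instInfinite
  refine eval_eq_zero_of_mul hF ((isHomogeneous_det (isHomogeneous_gramPoly (k := k) (m := m))).mul
    (isHomogeneous_gramPoly (Sum.inl 0) (Sum.inr 1))) (fun u hu => ?_) hw hw0 ?_
    ((mem_singularPoints_mk hy0).mp hy) hy0
  · rw [map_mul, eval_det_gramPoly, eval_gramPoly]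
    by_cases h1 : (gram (toMat u)).det = 0
    · rw [h1]; ring
    by_cases h2 : gram (toMat u) (Sum.inl 0) (Sum.inr 1) = 0
    · rw [h2]; ring
    have hu0 : u ≠ 0 := by
      rintro rfl
      exact h2 (by simp [gram, show toMat (0 : V k m) = 0 from rfl])
    have := hFO (Projectivization.mk k u hu0) ((mem_orbit_iff hv0 hu0).mpr
      (h.sameOrbit hv hu (isGeneric_of_apply_ne_zero h1 h2)))
    rw [eval_rep_eq_zero_iff hF] at this
    rw [this, zero_mul]
  · rw [map_mul, eval_det_gramPoly, eval_gramPoly]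
    exact mul_ne_zero hw1 hw2

/-- Both ways of failing to be generic are preserved along the orbit: the Gram determinant stays
zero, and a multiple of `J` stays a multiple of `J`. A homogeneous polynomial would then vanish on
the orbit but not on the quadric. -/
theorem isGeneric_of_hasDenseOrbit {r : ℕ} (e : Fin 2 ⊕ Fin r ≃ Fin m) {v : V k m}
    (hv0 : v ≠ 0) (h : HasDenseOrbit (Projectivization.mk k v hv0)) : IsGeneric (toMat v) := by
  obtain ⟨w, hw0, hw, hw1, hw2⟩ := exists_generic (k := k) e
  constructor
  · intro hd
    have hF := isHomogeneous_det (isHomogeneous_gramPoly (k := k) (m := m))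
    have := h _ _ hF (fun y hy => by
      induction y using Projectivization.ind with
      | h y hy0 =>
      obtain ⟨c, g, hg, H⟩ := gram_sameOrbit ((mem_orbit_iff hv0 hy0).mp hy)
      rw [eval_rep_eq_zero_iff hF, eval_det_gramPoly, H, Matrix.det_smul, Matrix.det_mul,
        Matrix.det_mul, hd]
      ring) _ ((mem_singularPoints_mk hw0).mpr hw)
    rw [eval_rep_eq_zero_iff hF, eval_det_gramPoly] at this
    exact hw1 this
  · intro a ha
    have hF := isHomogeneous_gramPoly (k := k) (m := m) (Sum.inl 0) (Sum.inr 1)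
    have := h _ _ hF (fun y hy => by
      induction y using Projectivization.ind with
      | h y hy0 =>
      obtain ⟨c, g, hg, H⟩ := gram_sameOrbit ((mem_orbit_iff hv0 hy0).mp hy)
      rw [eval_rep_eq_zero_iff hF, eval_gramPoly, H, ha, Matrix.mul_smul, Matrix.smul_mul,
        SymplecticGroup.mem_iff.mp hg]
      simp [J]) _ ((mem_singularPoints_mk hw0).mpr hw)
    rw [eval_rep_eq_zero_iff hF, eval_gramPoly] at this
    exact hw2 this

end Quadric

/-! ### Independence of the representative of an orbit -/

section Conjugation

variable {k : Type*} [Field k]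

theorem mk_eq_of_val_eq_smul {ι : Type*} [Fintype ι] [DecidableEq ι] {s t : GL ι k} {c : k}
    (hc : c ≠ 0) (h : (t : Matrix ι ι k) = c • (s : Matrix ι ι k)) :
    ProjGenLinGroup.mk t = ProjGenLinGroup.mk s := by
  refine (ProjGenLinGroup.mk_eq_mk_iff.mpr ⟨Units.mk0 c hc, ?_⟩).symm
  ext i j
  rw [h]
  simp [Matrix.GeneralLinearGroup.scalar, mul_comm]

theorem inducedStabilizer_smul {m : ℕ} {t : GL (Idx 2 × Idx m) k} (ht : t ∈ tensorGroup k m)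
    (x : ℙ k (V k m)) :
    inducedStabilizer (t • x) =
      (inducedStabilizer x).map (MulAut.conj (ProjGenLinGroup.mk t)).toMonoidHom := by
  ext y
  simp only [inducedStabilizer, Subgroup.mem_map, Subgroup.mem_inf, MulAction.mem_stabilizer_iff,
    exists_exists_and_eq_and, MulEquiv.coe_toMonoidHom, MulAut.conj_apply]
  constructor
  · rintro ⟨s, ⟨hs, hsx⟩, rfl⟩
    refine ⟨t⁻¹ * s * t, ⟨mul_mem (mul_mem (inv_mem ht) hs) ht, ?_⟩, ?_⟩
    · rw [mul_smul, mul_smul, hsx, inv_smul_smul]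
    · simp only [← map_inv, ← map_mul]
      congr 1
      group
  · rintro ⟨s, ⟨hs, hsx⟩, rfl⟩
    refine ⟨t * s * t⁻¹, ⟨mul_mem (mul_mem ht hs) (inv_mem ht), ?_⟩, by simp⟩
    rw [mul_smul, mul_smul, inv_smul_smul, hsx]

/-- Functions on `X × Sp_{2r}` that are polynomials in the matrix entries. -/
def IsPolynomialFun {r : ℕ} {X : Subgroup (GL (Fin 2 ⊕ Fin 2) k)} (f : X × Sp k r → k) : Prop :=
  ∃ P : MvPolynomial (((Fin 2 ⊕ Fin 2) × (Fin 2 ⊕ Fin 2)) ⊕ (Idx r × Idx r)) k,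
    ∀ g : X × Sp k r, f g = MvPolynomial.eval
      (Sum.elim (fun c => ((g.1 : GL (Fin 2 ⊕ Fin 2) k) : Matrix _ _ k) c.1 c.2)
        (fun c => (g.2 : Matrix (Idx r) (Idx r) k) c.1 c.2)) P

namespace IsPolynomialFun

variable {r : ℕ} {X : Subgroup (GL (Fin 2 ⊕ Fin 2) k)}

theorem const (c : k) : IsPolynomialFun (fun _ : X × Sp k r => c) :=
  ⟨MvPolynomial.C c, fun _ => by simp⟩

theorem fst (i j : Fin 2 ⊕ Fin 2) : IsPolynomialFun
    (fun g : X × Sp k r => ((g.1 : GL (Fin 2 ⊕ Fin 2) k) : Matrix _ _ k) i j) :=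
  ⟨MvPolynomial.X (Sum.inl (i, j)), fun _ => by simp⟩

theorem snd (i j : Idx r) : IsPolynomialFun
    (fun g : X × Sp k r => (g.2 : Matrix (Idx r) (Idx r) k) i j) :=
  ⟨MvPolynomial.X (Sum.inr (i, j)), fun _ => by simp⟩

theorem mul {f f' : X × Sp k r → k} (h : IsPolynomialFun f) (h' : IsPolynomialFun f') :
    IsPolynomialFun (fun g => f g * f' g) := by
  obtain ⟨P, hP⟩ := h
  obtain ⟨P', hP'⟩ := h'
  exact ⟨P * P', fun g => (congrArg₂ (· * ·) (hP g) (hP' g)).trans (map_mul _ _ _).symm⟩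

theorem sum {ι : Type*} (s : Finset ι) {f : ι → X × Sp k r → k}
    (h : ∀ i, IsPolynomialFun (f i)) : IsPolynomialFun (fun g => ∑ i ∈ s, f i g) := by
  choose P hP using h
  exact ⟨∑ i ∈ s, P i, fun g => by rw [map_sum]; exact Finset.sum_congr rfl fun i _ => hP i g⟩

theorem matrix_mul {l n o : Type*} [Fintype n] {A : X × Sp k r → Matrix l n k}
    {B : X × Sp k r → Matrix n o k} (hA : ∀ i j, IsPolynomialFun fun g => A g i j)
    (hB : ∀ i j, IsPolynomialFun fun g => B g i j) (i : l) (j : o) :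
    IsPolynomialFun fun g => (A g * B g) i j := by
  simp only [Matrix.mul_apply]
  exact sum _ fun a => (hA _ _).mul (hB _ _)

end IsPolynomialFun

theorem IsCentralProductWithSp.map_conj {ι : Type*} [Fintype ι] [DecidableEq ι]
    {X : Subgroup (GL (Fin 2 ⊕ Fin 2) k)} {r : ℕ} {S : Subgroup PGL(ι, k)}
    (h : IsCentralProductWithSp X r S) (t : GL ι k) :
    IsCentralProductWithSp X r (S.map (MulAut.conj (ProjGenLinGroup.mk t)).toMonoidHom) := by
  obtain ⟨ρ, hρ, hS, hker⟩ := h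
  have hcomp : ∀ g, (ProjGenLinGroup.mk.comp ((MulAut.conj t).toMonoidHom.comp ρ)) g =
      MulAut.conj (ProjGenLinGroup.mk t) ((ProjGenLinGroup.mk.comp ρ) g) := fun g => by simp
  refine ⟨(MulAut.conj t).toMonoidHom.comp ρ, ?_, ?_, fun g => ?_⟩
  · have h' : ∀ a b, IsPolynomialFun fun g => (ρ g : Matrix ι ι k) a b := hρ
    exact IsPolynomialFun.matrix_mul (IsPolynomialFun.matrix_mul
      (fun _ _ => IsPolynomialFun.const _) h') fun _ _ => IsPolynomialFun.const _
  · rw [← hS]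
    ext y
    simp only [MonoidHom.mem_range, Subgroup.mem_map, exists_exists_eq_and, hcomp]
    rfl
  · rw [hcomp, EmbeddingLike.map_eq_one_iff, hker]

theorem inducedStabilizer_of_sameOrbit {m r : ℕ} {X : Subgroup (GL (Fin 2 ⊕ Fin 2) k)}
    {v w : V k m} (hv : v ≠ 0) (hw : w ≠ 0) (h : SameOrbit (toMat v) (toMat w))
    (H : IsCentralProductWithSp X r (inducedStabilizer (Projectivization.mk k v hv))) :
    IsCentralProductWithSp X r (inducedStabilizer (Projectivization.mk k w hw)) := by
  obtain ⟨⟨t, ht⟩, htx⟩ := (mem_orbit_iff hv hw).mpr h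
  have htx' : t • Projectivization.mk k v hv = Projectivization.mk k w hw := htx
  rw [← htx', inducedStabilizer_smul ht]
  exact H.map_conj t

end Conjugation

/-! ### The stabilizer as the common stabilizer of two forms -/

section Stabilizer

variable {k : Type*} [Field k] {r m : ℕ}

/-- The homomorphism `(x, D) ↦ (R x R⁻¹) ⊗ (P x P⁻¹ ⊕ D)`. -/
noncomputable def stabHom (e : Fin 2 ⊕ Fin r ≃ Fin m) (X : Subgroup (GL (Fin 2 ⊕ Fin 2) k))
    {P R : Matrix (Idx 2) (Idx 2) k} (hP : IsUnit P.det) (hR : IsUnit R.det) :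
    X × Sp k r →* GL (Idx 2 × Idx m) k :=
  MonoidHom.toHomUnits
    { toFun := fun g => (R * ((g.1 : GL (Fin 2 ⊕ Fin 2) k) : Matrix (Idx 2) (Idx 2) k) * R⁻¹) ⊗ₖ
        blockSum e (P * ((g.1 : GL (Fin 2 ⊕ Fin 2) k) : Matrix (Idx 2) (Idx 2) k) * P⁻¹)
          (g.2 : Matrix (Idx r) (Idx r) k)
      map_one' := by
        simp [Matrix.mul_nonsing_inv _ hP, Matrix.mul_nonsing_inv _ hR, blockSum_one]
      map_mul' := fun g h => by
        rw [← Matrix.mul_kronecker_mul, blockSum_mul]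
        simp only [Prod.fst_mul, Prod.snd_mul, Subgroup.coe_mul, Units.val_mul, Submonoid.coe_mul,
          Matrix.mul_assoc, Matrix.nonsing_inv_mul_cancel_left _ _ hP,
          Matrix.nonsing_inv_mul_cancel_left _ _ hR] }

theorem coe_stabHom (e : Fin 2 ⊕ Fin r ≃ Fin m) (X : Subgroup (GL (Fin 2 ⊕ Fin 2) k))
    {P R : Matrix (Idx 2) (Idx 2) k} (hP : IsUnit P.det) (hR : IsUnit R.det) (g : X × Sp k r) :
    (stabHom e X hP hR g : Matrix (Idx 2 × Idx m) (Idx 2 × Idx m) k) =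
      (R * ((g.1 : GL (Fin 2 ⊕ Fin 2) k) : Matrix (Idx 2) (Idx 2) k) * R⁻¹) ⊗ₖ
        blockSum e (P * ((g.1 : GL (Fin 2 ⊕ Fin 2) k) : Matrix (Idx 2) (Idx 2) k) * P⁻¹)
          (g.2 : Matrix (Idx r) (Idx r) k) := rfl

theorem isPolynomialHom_stabHom (e : Fin 2 ⊕ Fin r ≃ Fin m)
    (X : Subgroup (GL (Fin 2 ⊕ Fin 2) k)) {P R : Matrix (Idx 2) (Idx 2) k} (hP : IsUnit P.det)
    (hR : IsUnit R.det) : IsPolynomialHom (stabHom e X hP hR) := by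
  have conj : ∀ (A B : Matrix (Idx 2) (Idx 2) k) (i j : Idx 2), IsPolynomialFun
      (fun g : X × Sp k r => (A * ((g.1 : GL (Fin 2 ⊕ Fin 2) k) :
        Matrix (Idx 2) (Idx 2) k) * B) i j) := fun A B =>
    IsPolynomialFun.matrix_mul (IsPolynomialFun.matrix_mul (fun _ _ => IsPolynomialFun.const _)
      IsPolynomialFun.fst) fun _ _ => IsPolynomialFun.const _
  have block : ∀ i j : Idx m, IsPolynomialFun (fun g : X × Sp k r =>
      blockSum e (P * ((g.1 : GL (Fin 2 ⊕ Fin 2) k) : Matrix (Idx 2) (Idx 2) k) * P⁻¹)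
          (g.2 : Matrix (Idx r) (Idx r) k) i j) := by
    intro i j
    obtain ⟨i, rfl⟩ := (idxEquiv e).surjective i
    obtain ⟨j, rfl⟩ := (idxEquiv e).surjective j
    simp only [blockSum, Matrix.submatrix_apply, Equiv.symm_apply_apply]
    rcases i with i | i <;> rcases j with j | j
    · exact conj P P⁻¹ i j
    · exact IsPolynomialFun.const 0
    · exact IsPolynomialFun.const 0
    · exact IsPolynomialFun.snd i j
  exact fun a b => (conj R R⁻¹ a.1 b.1).mul (block a.2 b.2)

/-- A Kronecker product that is scalar has scalar factors. -/
theorem kronecker_eq_smul_one {ι κ : Type*} [DecidableEq ι] [DecidableEq κ] [Nonempty ι]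
    [Nonempty κ] {G : Matrix ι ι k} {H : Matrix κ κ k} {c : k} (hc : c ≠ 0)
    (h : G ⊗ₖ H = c • 1) : (∃ a : k, G = a • 1) ∧ ∃ b : k, H = b • 1 := by
  have hGH : ∀ i i' j j', G i i' * H j j' =
      c * ((1 : Matrix ι ι k) i i' * (1 : Matrix κ κ k) j j') := by
    intro i i' j j'
    have := congrFun (congrFun h (i, j)) (i', j')
    simpa [Matrix.kroneckerMap_apply, Matrix.one_apply, ← ite_and, and_comm] using this
  obtain ⟨i₀⟩ := ‹Nonempty ι›
  obtain ⟨j₀⟩ := ‹Nonempty κ›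
  have h0 : G i₀ i₀ * H j₀ j₀ = c := by simpa using hGH i₀ i₀ j₀ j₀
  have hG0 : G i₀ i₀ ≠ 0 := fun h => hc (by rw [← h0, h, zero_mul])
  have hH0 : H j₀ j₀ ≠ 0 := fun h => hc (by rw [← h0, h, mul_zero])
  refine ⟨⟨c / H j₀ j₀, ?_⟩, c / G i₀ i₀, ?_⟩
  · ext i i'
    have := hGH i i' j₀ j₀
    rw [Matrix.one_apply_eq, mul_one] at this
    rw [Matrix.smul_apply, smul_eq_mul, div_mul_eq_mul_div, eq_div_iff hH0, this]
  · ext j j'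
    have := hGH i₀ i₀ j j'
    rw [Matrix.one_apply_eq, one_mul] at this
    rw [Matrix.smul_apply, smul_eq_mul, div_mul_eq_mul_div, eq_div_iff hG0, mul_comm, this]

theorem eq_smul_one_of_conj {P x : Matrix (Idx 2) (Idx 2) k} (hP : IsUnit P.det) {a : k}
    (h : P * x * P⁻¹ = a • 1) : x = a • 1 := by
  have h1 := congrArg (fun Z => P⁻¹ * Z * P) h
  simpa [Matrix.mul_assoc, Matrix.nonsing_inv_mul _ hP,
    Matrix.nonsing_inv_mul_cancel_left _ _ hP] using h1

theorem conj_mem_symplectic_iff {Φ P x : Matrix (Idx 2) (Idx 2) k} (hP : IsUnit P.det)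
    (hΦ : P * Φ * Pᵀ = J (Fin 2) k) (c : k) :
    c • (P * x * P⁻¹) ∈ symplecticGroup (Fin 2) k ↔ c ^ 2 • (x * Φ * xᵀ) = Φ := by
  have hPT : IsUnit Pᵀ.det := by rwa [Matrix.det_transpose]
  have key : c • (P * x * P⁻¹) * J (Fin 2) k * (c • (P * x * P⁻¹))ᵀ =
      P * (c ^ 2 • (x * Φ * xᵀ)) * Pᵀ := by
    rw [← hΦ]
    simp only [Matrix.transpose_smul, Matrix.transpose_mul, Matrix.smul_mul, Matrix.mul_smul,
      smul_smul, Matrix.mul_assoc, Matrix.nonsing_inv_mul_cancel_left _ _ hP,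
      Matrix.transpose_nonsing_inv, Matrix.mul_nonsing_inv_cancel_left _ _ hPT, sq]
  rw [SymplecticGroup.mem_iff, key]
  constructor
  · intro h
    rw [← hΦ] at h
    have h1 := congrArg (fun Z => P⁻¹ * Z * (Pᵀ)⁻¹) h
    simpa only [Matrix.mul_assoc, Matrix.nonsing_inv_mul_cancel_left _ _ hP,
      Matrix.mul_nonsing_inv _ hPT, Matrix.mul_one] using h1
  · intro h
    rw [h, hΦ]

theorem isUnit_det_of_congr_J {Φ P : Matrix (Idx 2) (Idx 2) k}
    (hΦ : P * Φ * Pᵀ = J (Fin 2) k) : IsUnit P.det := by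
  have h := isUnit_det_J (Fin 2) k
  rw [← hΦ, Matrix.det_mul, Matrix.det_mul, mul_assoc] at h
  exact isUnit_of_mul_isUnit_left h

/-- The factor `J` in the tensor `R P⁻¹ J` compensates for the transpose in the action, since `A J
Aᵀ = J` for symplectic `A`. The rest, `R P⁻¹`, intertwines the two conjugates of `x`. -/
theorem conj_mul_mul_conj_transpose {P R x : Matrix (Idx 2) (Idx 2) k} (hP : IsUnit P.det)
    (hR : IsUnit R.det) (hx : P * x * P⁻¹ ∈ symplecticGroup (Fin 2) k) :
    (R * x * R⁻¹) * (R * P⁻¹ * J (Fin 2) k) * (P * x * P⁻¹)ᵀ = R * P⁻¹ * J (Fin 2) k := by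
  rw [SymplecticGroup.mem_iff] at hx
  calc (R * x * R⁻¹) * (R * P⁻¹ * J (Fin 2) k) * (P * x * P⁻¹)ᵀ
      = R * P⁻¹ * ((P * x * P⁻¹) * J (Fin 2) k * (P * x * P⁻¹)ᵀ) := by
        simp only [Matrix.mul_assoc, Matrix.nonsing_inv_mul_cancel_left _ _ hP,
          Matrix.nonsing_inv_mul_cancel_left _ _ hR]
    _ = _ := by rw [hx]

theorem isUnit_det_seed {P R : Matrix (Idx 2) (Idx 2) k} (hP : IsUnit P.det)
    (hR : IsUnit R.det) : IsUnit (R * P⁻¹ * J (Fin 2) k).det := by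
  rw [Matrix.det_mul, Matrix.det_mul]
  exact (hR.mul ((Matrix.isUnit_nonsing_inv_det_iff).mpr hP)).mul (isUnit_det_J _ _)

/-- If `X` is the common stabilizer of the form `Φ` and of the form `Ψ` up to scalars, then the
stabilizer of a tensor built from isometries of `Φ` and `Ψ` with the standard form is a central
product of `X` and `Sp_{2r}`. -/
theorem isCentralProductWithSp_of_forms (e : Fin 2 ⊕ Fin r ≃ Fin m)
    {X : Subgroup (GL (Fin 2 ⊕ Fin 2) k)} {Φ Ψ P R : Matrix (Idx 2) (Idx 2) k}
    (hΦ : P * Φ * Pᵀ = J (Fin 2) k) (hΨ : R * Ψ * Rᵀ = J (Fin 2) k)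
    (hX : ∀ x : GL (Fin 2 ⊕ Fin 2) k, x ∈ X ↔
      ((x : Matrix (Idx 2) (Idx 2) k) * Φ * (x : Matrix (Idx 2) (Idx 2) k)ᵀ = Φ ∧
      ∃ c : k, c ≠ 0 ∧
        c ^ 2 • ((x : Matrix (Idx 2) (Idx 2) k) * Ψ * (x : Matrix (Idx 2) (Idx 2) k)ᵀ) = Ψ))
    (hv : ofMat (pad e (R * P⁻¹ * J (Fin 2) k)) ≠ 0) :
    IsCentralProductWithSp X r (inducedStabilizer (Projectivization.mk k _ hv)) := by
  have hP := isUnit_det_of_congr_J hΦ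
  have hR := isUnit_det_of_congr_J hΨ
  have hmem1 : ∀ x : Matrix (Idx 2) (Idx 2) k, P * x * P⁻¹ ∈ symplecticGroup (Fin 2) k ↔
      x * Φ * xᵀ = Φ := fun x => by
    simpa using conj_mem_symplectic_iff (x := x) hP hΦ 1
  have hmem2 := fun x : Matrix (Idx 2) (Idx 2) k => conj_mem_symplectic_iff (x := x) hR hΨ
  set M := R * P⁻¹ * J (Fin 2) k with hM
  have hMu : IsUnit M.det := isUnit_det_seed hP hR
  refine ⟨stabHom e X hP hR, isPolynomialHom_stabHom e X hP hR, ?_, fun g => ?_⟩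
  · ext y
    constructor
    · rintro ⟨⟨⟨x, hx⟩, D⟩, rfl⟩
      obtain ⟨hx1, c, hc, hx2⟩ := (hX x).mp hx
      rw [← hmem1] at hx1
      rw [← hmem2] at hx2
      -- Only `c • R x R⁻¹` is known to be symplectic, so `stabHom` need not take values in `H`
      -- itself. The scalar disappears in `PGL`.
      let p : Sp k 2 × Sp k m := (⟨_, hx2⟩, ⟨_, (blockSum_mem_iff e).mpr ⟨hx1, D.2⟩⟩)
      refine ⟨tensorHom k m p, ⟨⟨p, rfl⟩, ?_⟩, ?_⟩
      · have h1 : tensorHom k m p • ofMat (pad e M) = c • ofMat (pad e M) := by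
          rw [tensorHom_smul, toMat_ofMat, blockSum_transpose, mul_pad, pad_mul_blockSum,
            Matrix.smul_mul, Matrix.smul_mul, conj_mul_mul_conj_transpose hP hR hx1, pad_smul,
            ofMat_smul]
        change tensorHom k m p • Projectivization.mk k (ofMat (pad e M)) hv =
          Projectivization.mk k (ofMat (pad e M)) hv
        rw [Projectivization.smul_mk, Projectivization.mk_eq_mk_iff']
        exact ⟨c, h1.symm⟩
      · refine mk_eq_of_val_eq_smul hc ?_
        rw [coe_tensorHom, coe_stabHom]
        exact Matrix.smul_kronecker _ _ _
    · rintro ⟨_, ⟨⟨p, rfl⟩, hp⟩, rfl⟩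
      replace hp : tensorHom k m p • Projectivization.mk k (ofMat (pad e M)) hv =
          Projectivization.mk k (ofMat (pad e M)) hv := hp
      rw [Projectivization.smul_mk, Projectivization.mk_eq_mk_iff'] at hp
      obtain ⟨a, ha⟩ := hp
      have ha0 : a ≠ 0 := by
        rintro rfl
        rw [zero_smul] at ha
        exact ((smul_ne_zero_iff_ne _).mpr hv) ha.symm
      rw [tensorHom_smul, toMat_ofMat] at ha
      have ha' := (congrArg toMat ha).symm
      rw [toMat_ofMat, toMat_smul, toMat_ofMat] at ha'
      have hg := SymplecticGroup.symplectic_det p.1.2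
      obtain ⟨A, hA, D, hD, hAD, hgA⟩ := exists_blockSum_of_stabilizes e hg hMu p.2.2 ha'
      have hAu := SymplecticGroup.symplectic_det hA
      -- The element `x` is recovered from `A` alone: the tensor has invertible matrix `M`, so `g M
      -- Aᵀ = a M` forces `g = a • R x R⁻¹`.
      let x : GL (Fin 2 ⊕ Fin 2) k := Matrix.nonsingInvUnit (P⁻¹ * A * P) (by
        rw [Matrix.det_mul, Matrix.det_mul]
        exact (((Matrix.isUnit_nonsing_inv_det_iff).mpr hP).mul hAu).mul hP)
      have hxv : (x : Matrix (Idx 2) (Idx 2) k) = P⁻¹ * A * P := rfl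
      have hxA : P * (x : Matrix (Idx 2) (Idx 2) k) * P⁻¹ = A := by
        simp only [hxv, Matrix.mul_assoc, Matrix.mul_nonsing_inv _ hP, Matrix.mul_one,
          Matrix.mul_nonsing_inv_cancel_left _ _ hP]
      have hxg : a • (R * (x : Matrix (Idx 2) (Idx 2) k) * R⁻¹) =
          (p.1 : Matrix (Idx 2) (Idx 2) k) := by
        have h1 := conj_mul_mul_conj_transpose (R := R) (x := (x : Matrix (Idx 2) (Idx 2) k)) hP hR
          (by rwa [hxA])
        rw [hxA, ← hM] at h1
        have hu : IsUnit (M * Aᵀ).det := by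
          rw [Matrix.det_mul, Matrix.det_transpose]
          exact hMu.mul hAu
        have h2 : (a • (R * (x : Matrix (Idx 2) (Idx 2) k) * R⁻¹)) * (M * Aᵀ) =
            (p.1 : Matrix (Idx 2) (Idx 2) k) * (M * Aᵀ) := by
          rw [Matrix.smul_mul, ← Matrix.mul_assoc, h1, ← Matrix.mul_assoc, hgA]
        have h3 := congrArg (fun Z => Z * (M * Aᵀ)⁻¹) h2
        simpa only [Matrix.mul_nonsing_inv_cancel_right _ _ hu] using h3
      have hxX : x ∈ X := by
        refine (hX x).mpr ⟨(hmem1 _).mp (by rwa [hxA]), a, ha0, (hmem2 _ a).mp ?_⟩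
        rw [hxg]
        exact p.1.2
      refine ⟨(⟨x, hxX⟩, ⟨D, hD⟩), ?_⟩
      refine (mk_eq_of_val_eq_smul ha0 ?_).symm
      rw [coe_tensorHom, coe_stabHom, ← hxg, hAD]
      simp only [hxA]
      exact Matrix.smul_kronecker _ _ _
  · obtain ⟨⟨x, hx⟩, D⟩ := g
    rw [MonoidHom.comp_apply, ProjGenLinGroup.mk_eq_one,
      Matrix.GeneralLinearGroup.mem_center_iff_val_mem_range_scalar]
    constructor
    · rintro ⟨c, hc⟩
      rw [coe_stabHom] at hc
      have hc0 : c ≠ 0 := by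
        rintro rfl
        rw [map_zero] at hc
        have h1 := (stabHom e X hP hR (⟨x, hx⟩, D)).isUnit
        rw [coe_stabHom, ← hc] at h1
        have : Nonempty (Idx 2 × Idx m) := ⟨(Sum.inl 0, Sum.inl (e (Sum.inl 0)))⟩
        exact not_isUnit_zero h1
      have : Nonempty (Idx m) := ⟨Sum.inl (e (Sum.inl 0))⟩
      obtain ⟨⟨a, ha⟩, b, hb⟩ := kronecker_eq_smul_one hc0 (by
        rw [← hc, Matrix.scalar_apply, Matrix.smul_one_eq_diagonal])
      rw [← blockSum_smul_one e, blockSum_injective] at hb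
      have hxb := eq_smul_one_of_conj hP hb.1
      -- A scalar symplectic matrix is `±1`, and the same scalar `b` occurs in `x` and in `D`.
      have hb2 : b * b = 1 := by
        have h1 := (hmem1 _).mpr ((hX x).mp hx).1
        rw [hb.1, SymplecticGroup.mem_iff] at h1
        have h2 := congrFun (congrFun h1 (Sum.inr 0)) (Sum.inl 0)
        simpa [J, Matrix.smul_mul] using h2
      rcases mul_self_eq_one_iff.mp hb2 with rfl | rfl
      · left
        exact ⟨by simpa using hxb, by simpa using hb.2⟩
      · right
        exact ⟨by simpa using hxb, by simpa using hb.2⟩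
    · rintro (⟨h1, h2⟩ | ⟨h1, h2⟩)
      · refine ⟨1, ?_⟩
        rw [coe_stabHom, h1, h2]
        simp [Matrix.mul_nonsing_inv _ hP, Matrix.mul_nonsing_inv _ hR, blockSum_one]
      · refine ⟨1, ?_⟩
        rw [coe_stabHom, h1, h2]
        have := blockSum_smul_one (r := r) e (-1 : k)
        rw [neg_one_smul, neg_one_smul, neg_one_smul] at this
        have hk : (-1 : Matrix (Idx 2) (Idx 2) k) ⊗ₖ (-1 : Matrix (Idx m) (Idx m) k) = 1 := by
          rw [← neg_one_smul k (1 : Matrix (Idx 2) (Idx 2) k),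
            ← neg_one_smul k (1 : Matrix (Idx m) (Idx m) k), Matrix.smul_kronecker,
            Matrix.kronecker_smul, smul_smul]
          simp
        simp [Matrix.mul_nonsing_inv _ hP, Matrix.mul_nonsing_inv _ hR, this, hk]

end Stabilizer

/-! ### The two pairs of forms and their stabilizers -/

section Forms

variable {k : Type*} [Field k]

/-- The symplectic form on a plane. -/
def planeForm (k : Type*) [Field k] : Matrix (Fin 2) (Fin 2) k := !![0, -1; 1, 0]

theorem det_planeForm : (planeForm k).det = 1 := by
  simp [planeForm, Matrix.det_fin_two]

theorem planeForm_ne_zero : planeForm k ≠ 0 := fun h => by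
  have := congrFun (congrFun h 1) 0
  simp [planeForm] at this

theorem mul_planeForm_mul_transpose (A : Matrix (Fin 2) (Fin 2) k) :
    A * planeForm k * Aᵀ = A.det • planeForm k := by
  ext i j
  fin_cases i <;> fin_cases j <;>
    simp [planeForm, Matrix.mul_apply, Fin.sum_univ_two, Matrix.det_fin_two] <;> ring

theorem smul_planeForm_inj {a b : k} : a • planeForm k = b • planeForm k ↔ a = b :=
  (smul_left_injective k planeForm_ne_zero).eq_iff

theorem eq_zero_of_mul_planeForm_mul {A B : Matrix (Fin 2) (Fin 2) k} (hA : A.det ≠ 0)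
    (h : A * planeForm k * Bᵀ = 0) : B = 0 := by
  have hu : IsUnit (A * planeForm k).det := by
    rw [Matrix.det_mul, det_planeForm, mul_one]
    exact isUnit_iff_ne_zero.mpr hA
  have h1 := congrArg (fun Z => ((A * planeForm k)⁻¹ * Z)ᵀ) h
  simpa [Matrix.nonsing_inv_mul_cancel_left _ _ hu] using h1

theorem eq_zero_of_mul_planeForm_mul' {A B : Matrix (Fin 2) (Fin 2) k} (hB : B.det ≠ 0)
    (h : A * planeForm k * Bᵀ = 0) : A = 0 := by
  refine eq_zero_of_mul_planeForm_mul (B := A) hB ?_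
  have h1 := congrArg Matrix.transpose h
  have h2 : (planeForm k)ᵀ = -planeForm k := by
    ext i j
    fin_cases i <;> fin_cases j <;> simp [planeForm]
  simpa [Matrix.transpose_mul, h2, Matrix.mul_assoc] using h1

/-- The sum of the symplectic forms on two orthogonal planes. -/
def sumForm (k : Type*) [Field k] : Matrix (Idx 2) (Idx 2) k :=
  fromBlocks (planeForm k) 0 0 (planeForm k)

/-- The difference of the symplectic forms on two orthogonal planes. -/
def diffForm (k : Type*) [Field k] : Matrix (Idx 2) (Idx 2) k :=
  fromBlocks (planeForm k) 0 0 (-planeForm k)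

/-- Interchanging the planes negates the difference form, so the scalar there must be a square root
of `-1`. Conversely, adding the off-diagonal conditions for the two forms and dividing by 2 gives `a
ω cᵀ = 0`, hence `b ω dᵀ = 0`, where `ω` is the form of a plane. With `det a + det b = 1` and `det c
+ det d = 1`, either the diagonal or the off-diagonal blocks vanish. -/
theorem mem_A1A1two_iff [IsAlgClosed k] (h2 : (2 : k) ≠ 0) (x : GL (Fin 2 ⊕ Fin 2) k) : x ∈ A1A1two k ↔
    ((x : Matrix (Idx 2) (Idx 2) k) * sumForm k * (x : Matrix (Idx 2) (Idx 2) k)ᵀ = sumForm k ∧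
      ∃ c : k, c ≠ 0 ∧ c ^ 2 • ((x : Matrix (Idx 2) (Idx 2) k) * diffForm k *
        (x : Matrix (Idx 2) (Idx 2) k)ᵀ) = diffForm k) := by
  have expand : ∀ (a b c d j j' : Matrix (Fin 2) (Fin 2) k),
      fromBlocks a b c d * fromBlocks j 0 0 j' * (fromBlocks a b c d)ᵀ =
        fromBlocks (a * j * aᵀ + b * j' * bᵀ) (a * j * cᵀ + b * j' * dᵀ)
          (c * j * aᵀ + d * j' * bᵀ) (c * j * cᵀ + d * j' * dᵀ) := by
    intro a b c d j j'
    simp [fromBlocks_transpose, fromBlocks_multiply]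
  constructor
  · rintro ⟨A, D, hA, hD, hx | hx⟩
    · rw [hx, sumForm, diffForm, expand, expand]
      refine ⟨?_, 1, one_ne_zero, ?_⟩ <;> simp [mul_planeForm_mul_transpose, hA, hD]
    · obtain ⟨i, hi⟩ := IsAlgClosed.exists_pow_nat_eq (-1 : k) (n := 2) (by norm_num)
      rw [hx, sumForm, diffForm, expand, expand]
      refine ⟨?_, i, ?_, ?_⟩
      · simp [mul_planeForm_mul_transpose, hA, hD]
      · rintro rfl
        simp at hi
      · simp [mul_planeForm_mul_transpose, hA, hD, hi, fromBlocks_neg]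
  · obtain ⟨a, b, c, d, hx⟩ : ∃ a b c d, (x : Matrix (Idx 2) (Idx 2) k) = fromBlocks a b c d :=
      ⟨_, _, _, _, (fromBlocks_toBlocks _).symm⟩
    rw [hx, sumForm, diffForm, expand, expand]
    rintro ⟨hs, t, ht, hdiff⟩
    rw [fromBlocks_smul, fromBlocks_inj] at hdiff
    rw [fromBlocks_inj] at hs
    obtain ⟨s11, s12, -, s22⟩ := hs
    obtain ⟨-, d12, -, -⟩ := hdiff
    simp only [mul_planeForm_mul_transpose, ← add_smul] at s11 s22
    simp only [Matrix.mul_neg, Matrix.neg_mul] at d12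
    rw [smul_eq_zero_iff_right (pow_ne_zero 2 ht)] at d12
    have det1 : a.det + b.det = 1 := by
      rwa [← smul_planeForm_inj, one_smul]
    have det2 : c.det + d.det = 1 := by
      rwa [← smul_planeForm_inj, one_smul]
    have hac : a * planeForm k * cᵀ = 0 := by
      have : (2 : k) • (a * planeForm k * cᵀ) = 0 := by
        rw [two_smul]
        have := congrArg₂ (· + ·) s12 d12
        simpa [add_add_add_comm] using this
      exact (smul_eq_zero.mp this).resolve_left h2
    have hbd : b * planeForm k * dᵀ = 0 := by rwa [hac, zero_add] at s12
    by_cases ha : a.det = 0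
    · have hb : b.det = 1 := by rwa [ha, zero_add] at det1
      have hd0 : d = 0 := eq_zero_of_mul_planeForm_mul (by rw [hb]; exact one_ne_zero) hbd
      have hc : c.det = 1 := by simpa [hd0] using det2
      have ha0 : a = 0 := eq_zero_of_mul_planeForm_mul' (by rw [hc]; exact one_ne_zero) hac
      exact ⟨b, c, hb, hc, Or.inr (by rw [hx, ha0, hd0])⟩
    · have hc0 : c = 0 := eq_zero_of_mul_planeForm_mul ha hac
      have hd : d.det = 1 := by simpa [hc0] using det2
      have hb0 : b = 0 := eq_zero_of_mul_planeForm_mul' (by rw [hd]; exact one_ne_zero) hbd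
      have ha1 : a.det = 1 := by simpa [hb0] using det1
      exact ⟨a, d, ha1, hd, Or.inl (by rw [hx, hb0, hc0])⟩

/-- The permutation of coordinates that carries `sumForm` to the standard symplectic form. -/
def planePerm (k : Type*) [Field k] : Matrix (Idx 2) (Idx 2) k :=
  fromBlocks !![1, 0; 0, 0] !![0, 0; 1, 0] !![0, 1; 0, 0] !![0, 0; 0, 1]

theorem planePerm_congr : planePerm k * sumForm k * (planePerm k)ᵀ = J (Fin 2) k := by
  rw [planePerm, sumForm, J, fromBlocks_transpose, fromBlocks_multiply, fromBlocks_multiply]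
  congr 1 <;>
    simp [planeForm, ← Matrix.ext_iff, Fin.forall_fin_two, Matrix.vecMul, dotProduct]

theorem planePerm_diffForm : planePerm k * diffForm k * (planePerm k)ᵀ =
    fromBlocks 0 (-!![1, 0; 0, -1]) !![1, 0; 0, -1] 0 := by
  rw [planePerm, diffForm, fromBlocks_transpose, fromBlocks_multiply, fromBlocks_multiply]
  congr 1 <;>
    simp [planeForm, ← Matrix.ext_iff, Fin.forall_fin_two, funext_iff, Matrix.vecMul, dotProduct]

/-- The scaling by `c` of the second plane. -/
def scaleSecond (c : k) : Matrix (Idx 2) (Idx 2) k := fromBlocks 1 0 0 (c • 1)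

theorem scaleSecond_diffForm {c : k} (hc : c ^ 2 = -1) :
    scaleSecond c * diffForm k * (scaleSecond c)ᵀ = sumForm k := by
  rw [scaleSecond, diffForm, sumForm, fromBlocks_transpose, fromBlocks_multiply,
    fromBlocks_multiply]
  simp [smul_smul, ← sq, hc]

theorem scaleSecond_sumForm {c : k} (hc : c ^ 2 = -1) :
    scaleSecond c * sumForm k * (scaleSecond c)ᵀ = diffForm k := by
  rw [scaleSecond, diffForm, sumForm, fromBlocks_transpose, fromBlocks_multiply,
    fromBlocks_multiply]
  simp [smul_smul, ← sq, hc]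

/-- The sum of the standard form and a form of rank two. -/
def unipForm (k : Type*) [Field k] : Matrix (Idx 2) (Idx 2) k :=
  fromBlocks (-planeForm k) (-1) 1 0

/-- The rank-two difference of the forms singles out a plane, which forces the lower left block `c`
to vanish; the remaining conditions are `det a = 1`, `d = a^{-T}` and the symmetry of `a⁻¹ b`. The
characteristic plays no role here. -/
theorem mem_U3A1_iff (x : GL (Fin 2 ⊕ Fin 2) k) : x ∈ U3A1 k ↔
    ((x : Matrix (Idx 2) (Idx 2) k) * unipForm k * (x : Matrix (Idx 2) (Idx 2) k)ᵀ = unipForm k ∧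
      ∃ c : k, c ≠ 0 ∧ c ^ 2 • ((x : Matrix (Idx 2) (Idx 2) k) * J (Fin 2) k *
        (x : Matrix (Idx 2) (Idx 2) k)ᵀ) = J (Fin 2) k) := by
  have expand : ∀ a b c d j : Matrix (Fin 2) (Fin 2) k,
      fromBlocks a b c d * fromBlocks j (-1) 1 0 * (fromBlocks a b c d)ᵀ =
        fromBlocks (a * j * aᵀ + (b * aᵀ - a * bᵀ)) (a * j * cᵀ + (b * cᵀ - a * dᵀ))
          (c * j * aᵀ + (d * aᵀ - c * bᵀ)) (c * j * cᵀ + (d * cᵀ - c * dᵀ)) := by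
    intro a b c d j
    rw [fromBlocks_transpose, fromBlocks_multiply, fromBlocks_multiply]
    congr 1 <;> simp only [Matrix.add_mul, Matrix.mul_neg, Matrix.neg_mul, Matrix.mul_one,
      Matrix.mul_zero, add_zero] <;> abel
  constructor
  · rintro ⟨A, S, hA, hS, hx⟩
    have hu : IsUnit A.det := by rw [hA]; exact isUnit_one
    have huT : IsUnit Aᵀ.det := by rwa [Matrix.det_transpose]
    have e1 : A * S * Aᵀ - A * (Sᵀ * Aᵀ) = 0 := by
      rw [hS, Matrix.mul_assoc, sub_self]
    have e2 : (A⁻¹)ᵀ * Aᵀ = 1 := by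
      rw [← Matrix.transpose_mul, Matrix.mul_nonsing_inv _ hu, Matrix.transpose_one]
    rw [hx, unipForm, J, expand, expand]
    refine ⟨?_, 1, one_ne_zero, ?_⟩ <;>
      simp [e1, e2, mul_planeForm_mul_transpose, hA, Matrix.mul_nonsing_inv _ hu]
  · obtain ⟨a, b, c, d, hx⟩ : ∃ a b c d, (x : Matrix (Idx 2) (Idx 2) k) = fromBlocks a b c d :=
      ⟨_, _, _, _, (fromBlocks_toBlocks _).symm⟩
    rw [hx, unipForm, J, expand, expand]
    rintro ⟨hs, t, ht, hJ⟩
    rw [fromBlocks_smul, fromBlocks_inj] at hJ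
    rw [fromBlocks_inj] at hs
    obtain ⟨s11, s12, -, s22⟩ := hs
    obtain ⟨j11, j12, -, j22⟩ := hJ
    have ht2 := pow_ne_zero 2 ht
    simp only [Matrix.mul_zero, Matrix.zero_mul, zero_add] at j11 j12 j22
    rw [smul_eq_zero_iff_right ht2] at j11 j22
    simp only [Matrix.mul_neg, Matrix.neg_mul, mul_planeForm_mul_transpose] at s11 s12 s22
    rw [j11, add_zero, neg_inj] at s11
    rw [j22, add_zero, neg_eq_zero] at s22
    have ha : a.det = 1 := by rwa [← smul_planeForm_inj, one_smul]
    have hc : c.det = 0 := by rwa [← smul_planeForm_inj, zero_smul]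
    have j12' : b * cᵀ - a * dᵀ = -((t ^ 2)⁻¹ • 1) := by
      rw [← inv_smul_smul₀ ht2 (b * cᵀ - a * dᵀ), j12, smul_neg]
    have hac : a * planeForm k * cᵀ = (1 - (t ^ 2)⁻¹) • 1 := by
      rw [j12'] at s12
      rw [sub_smul, one_smul]
      have h1 := congrArg Neg.neg s12
      simp only [neg_add, neg_neg] at h1
      exact eq_sub_of_add_eq h1
    -- The scalar matrix `a ω cᵀ` has determinant `det a * det c = 0`, so it is zero.
    have hc0 : c = 0 := by
      refine eq_zero_of_mul_planeForm_mul (A := a) (by rw [ha]; exact one_ne_zero) ?_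
      have h1 := congrArg Matrix.det hac
      rw [Matrix.det_mul, Matrix.det_transpose, hc, mul_zero, Matrix.det_smul, Matrix.det_one,
        mul_one, Fintype.card_fin] at h1
      rw [hac, pow_eq_zero_iff two_ne_zero |>.mp h1.symm, zero_smul]
    have hu : IsUnit a.det := by rw [ha]; exact isUnit_one
    have huT : IsUnit aᵀ.det := by rwa [Matrix.det_transpose]
    have had : a * dᵀ = 1 := by simpa [hc0] using s12
    have hd : d = (a⁻¹)ᵀ := by
      rw [Matrix.inv_eq_right_inv had, Matrix.transpose_transpose]
    refine ⟨a, a⁻¹ * b, ha, ?_, ?_⟩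
    · have h1 : b * aᵀ = a * bᵀ := sub_eq_zero.mp j11
      have h2 : a⁻¹ * (b * aᵀ) * (aᵀ)⁻¹ = a⁻¹ * (a * bᵀ) * (aᵀ)⁻¹ := by rw [h1]
      rw [Matrix.nonsing_inv_mul_cancel_left _ _ hu, ← Matrix.mul_assoc,
        Matrix.mul_nonsing_inv_cancel_right _ _ huT] at h2
      rw [Matrix.transpose_mul, Matrix.transpose_nonsing_inv, h2]
    · rw [hx, hc0, hd, Matrix.mul_nonsing_inv_cancel_left _ _ hu]

/-- An isometry from `unipForm` to the standard symplectic form. -/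
def unipIsom (k : Type*) [Field k] : Matrix (Idx 2) (Idx 2) k :=
  fromBlocks 1 (-!![0, 1; 0, 0]) 0 1

theorem unipIsom_congr : unipIsom k * unipForm k * (unipIsom k)ᵀ = J (Fin 2) k := by
  rw [unipIsom, unipForm, J, fromBlocks_transpose, fromBlocks_multiply, fromBlocks_multiply]
  congr 1 <;> simp [planeForm, ← Matrix.ext_iff, Fin.forall_fin_two]

/-- The Gram matrix of the representative is `Φ` transported by `R`, so singularity and genericity
become conditions on the pair of forms. -/
theorem gram_pad_seed {r m : ℕ} (e : Fin 2 ⊕ Fin r ≃ Fin m) {Φ P : Matrix (Idx 2) (Idx 2) k}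
    (R : Matrix (Idx 2) (Idx 2) k) (hΦ : P * Φ * Pᵀ = J (Fin 2) k) :
    gram (pad e (R * P⁻¹ * J (Fin 2) k)) = R * Φ * Rᵀ := by
  have hP := isUnit_det_of_congr_J hΦ
  have hPT : IsUnit Pᵀ.det := by rwa [Matrix.det_transpose]
  have hJ : J (Fin 2) k * J (Fin 2) k * (J (Fin 2) k)ᵀ = J (Fin 2) k := by
    rw [J_squared, J_transpose]; simp
  calc gram (pad e (R * P⁻¹ * J (Fin 2) k))
      = R * P⁻¹ * (J (Fin 2) k * J (Fin 2) k * (J (Fin 2) k)ᵀ) * (R * P⁻¹)ᵀ := by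
        rw [gram_pad]
        simp only [Matrix.transpose_mul, Matrix.mul_assoc]
    _ = R * Φ * Rᵀ := by
        rw [hJ, ← hΦ]
        simp only [Matrix.transpose_mul, Matrix.mul_assoc,
          Matrix.nonsing_inv_mul_cancel_left _ _ hP, Matrix.transpose_nonsing_inv,
          Matrix.mul_nonsing_inv_cancel_left _ _ hPT]

/-- The stabilizer of a point in the dense orbit, from a description of its two forms. -/
theorem isCentralProductWithSp_of_isGeneric [IsAlgClosed k] {r m : ℕ}
    (e : Fin 2 ⊕ Fin r ≃ Fin m) {X : Subgroup (GL (Fin 2 ⊕ Fin 2) k)}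
    {Φ Ψ P R : Matrix (Idx 2) (Idx 2) k}
    (hΦ : P * Φ * Pᵀ = J (Fin 2) k) (hΨ : R * Ψ * Rᵀ = J (Fin 2) k)
    (hX : ∀ x : GL (Fin 2 ⊕ Fin 2) k, x ∈ X ↔
      ((x : Matrix (Idx 2) (Idx 2) k) * Φ * (x : Matrix (Idx 2) (Idx 2) k)ᵀ = Φ ∧
      ∃ c : k, c ≠ 0 ∧
        c ^ 2 • ((x : Matrix (Idx 2) (Idx 2) k) * Ψ * (x : Matrix (Idx 2) (Idx 2) k)ᵀ) = Ψ))
    (htr : (R * Φ * Rᵀ) (Sum.inl 0) (Sum.inr 0) + (R * Φ * Rᵀ) (Sum.inl 1) (Sum.inr 1) = 0)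
    (hJ : ∀ a : k, R * Φ * Rᵀ ≠ a • J (Fin 2) k)
    {v : V k m} (hv : v ≠ 0) (hQ : Q v = 0) (hgen : IsGeneric (toMat v)) :
    IsCentralProductWithSp X r (inducedStabilizer (Projectivization.mk k v hv)) := by
  have hP := isUnit_det_of_congr_J hΦ
  have hR := isUnit_det_of_congr_J hΨ
  have hgram := gram_pad_seed e R hΦ
  have hw : ofMat (pad e (R * P⁻¹ * J (Fin 2) k)) ≠ 0 := by
    refine ofMat_ne_zero fun h => hJ 0 ?_
    rw [← hgram, h, zero_smul]
    simp [gram]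
  have hQw : Q (ofMat (pad e (R * P⁻¹ * J (Fin 2) k))) = 0 := by
    rw [Q_eq_gram, toMat_ofMat, hgram, htr, neg_zero]
  have hgw : IsGeneric (toMat (ofMat (pad e (R * P⁻¹ * J (Fin 2) k)))) := by
    rw [toMat_ofMat]
    refine ⟨?_, fun a => by rw [hgram]; exact hJ a⟩
    have hM := isUnit_det_seed hP hR
    rw [gram_pad, Matrix.det_mul, Matrix.det_mul, Matrix.det_transpose]
    exact ((hM.mul (isUnit_det_J _ _)).mul hM).ne_zero
  exact inducedStabilizer_of_sameOrbit hw hv (hgw.sameOrbit hQw hQ hgen)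
    (isCentralProductWithSp_of_forms e hΦ hΨ hX hw)

/-- Here `Φ` is the sum form and `Ψ` the difference form. Scaling the second plane by a square root
of `-1` interchanges them, so the Gram matrix is the difference form in standard coordinates. It is
traceless, and not a multiple of `J` because `1 ≠ -1`. -/
theorem isCentralProductWithSp_A1A1two [IsAlgClosed k] (h2 : (2 : k) ≠ 0) {r m : ℕ}
    (e : Fin 2 ⊕ Fin r ≃ Fin m) {v : V k m} (hv : v ≠ 0) (hQ : Q v = 0)
    (hgen : IsGeneric (toMat v)) :
    IsCentralProductWithSp (A1A1two k) r (inducedStabilizer (Projectivization.mk k v hv)) := by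
  obtain ⟨c, hc⟩ := IsAlgClosed.exists_pow_nat_eq (-1 : k) (n := 2) (by norm_num)
  have hR : planePerm k * scaleSecond c * sumForm k * (planePerm k * scaleSecond c)ᵀ =
      fromBlocks 0 (-!![1, 0; 0, -1]) !![1, 0; 0, -1] 0 := by
    rw [Matrix.transpose_mul, ← planePerm_diffForm, ← scaleSecond_sumForm hc]
    simp only [Matrix.mul_assoc]
  refine isCentralProductWithSp_of_isGeneric e (P := planePerm k)
    (R := planePerm k * scaleSecond c) planePerm_congr ?_ (mem_A1A1two_iff h2) ?_ ?_ hv hQ hgen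
  · rw [Matrix.transpose_mul, ← planePerm_congr, ← scaleSecond_diffForm hc]
    simp only [Matrix.mul_assoc]
  · rw [hR]
    simp
  · intro a ha
    rw [hR] at ha
    have h0 := congrFun (congrFun ha (Sum.inr 0)) (Sum.inl 0)
    have h1 := congrFun (congrFun ha (Sum.inr 1)) (Sum.inl 1)
    simp [J] at h0 h1
    refine h2 ?_
    linear_combination h0 - h1

/-- Here `Φ` is `unipForm` and `Ψ = J`, so the Gram matrix is `unipForm` itself. Its contraction is
`-2`, which vanishes only in characteristic two, and its rank-two part keeps it from being a
multiple of `J`. -/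
theorem isCentralProductWithSp_U3A1 [IsAlgClosed k] (h2 : (2 : k) = 0) {r m : ℕ}
    (e : Fin 2 ⊕ Fin r ≃ Fin m) {v : V k m} (hv : v ≠ 0) (hQ : Q v = 0)
    (hgen : IsGeneric (toMat v)) :
    IsCentralProductWithSp (U3A1 k) r (inducedStabilizer (Projectivization.mk k v hv)) := by
  refine isCentralProductWithSp_of_isGeneric e (Ψ := J (Fin 2) k) (R := 1) unipIsom_congr
    (by simp) mem_U3A1_iff ?_ ?_ hv hQ hgen
  · simp only [Matrix.one_mul, Matrix.transpose_one, Matrix.mul_one, unipForm, fromBlocks_apply₁₂,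
      Matrix.neg_apply, Matrix.one_apply_eq]
    linear_combination -h2
  · intro a ha
    have h0 := congrFun (congrFun ha (Sum.inl 0)) (Sum.inl 1)
    simp [J, unipForm, planeForm] at h0

end Forms

end TensorSp

theorem mainTheorem12 (k : Type*) [Field k] [IsAlgClosed k] (m : ℕ) (hm : 2 ≤ m) :
    {O : Set (Projectivization k (TensorSp.V k m)) |
        ∃ x ∈ TensorSp.singularPoints k m, O = TensorSp.orbit x}.Finite ∧
    (∃ x ∈ TensorSp.singularPoints k m, TensorSp.HasDenseOrbit x) ∧
    ∀ x ∈ TensorSp.singularPoints k m, TensorSp.HasDenseOrbit x →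
      (ringChar k ≠ 2 →
        TensorSp.IsCentralProductWithSp (TensorSp.A1A1two k) (m - 2)
          (TensorSp.inducedStabilizer x)) ∧
      (ringChar k = 2 →
        TensorSp.IsCentralProductWithSp (TensorSp.U3A1 k) (m - 2)
          (TensorSp.inducedStabilizer x)) := by
  -- The bound `2 ≤ m` makes room for `W_4` in `W_{2m}`; any such bijection will do.
  have e : Fin 2 ⊕ Fin (m - 2) ≃ Fin m := finSumFinEquiv.trans (finCongr (by omega))
  refine ⟨TensorSp.finite_orbits k m, ?_, fun x hx hd => ?_⟩
  · obtain ⟨v, hv0, hv, h1, h2⟩ := TensorSp.exists_generic (k := k) e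
    exact ⟨Projectivization.mk k v hv0, (TensorSp.mem_singularPoints_mk hv0).mpr hv,
      (TensorSp.isGeneric_of_apply_ne_zero h1 h2).hasDenseOrbit e hv0 hv⟩
  · induction x using Projectivization.ind with
    | h v hv0 =>
    have hv := (TensorSp.mem_singularPoints_mk hv0).mp hx
    have hg := TensorSp.isGeneric_of_hasDenseOrbit e hv0 hd
    refine ⟨fun hp => ?_, fun hp => ?_⟩
    · exact TensorSp.isCentralProductWithSp_A1A1two (Ring.two_ne_zero hp) e hv0 hv hg
    · refine TensorSp.isCentralProductWithSp_U3A1 ?_ e hv0 hv hg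
      have := ringChar.Nat.cast_ringChar (R := k)
      rw [hp] at this
      exact_mod_cast this
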